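/- Throughout, homology and cohomology are singular with integer coefficients, and manifolds are smooth. A closed $k$-manifold is a compact $k$-manifold without boundary. A closed orientable $m$-dimensional manifold $N$ satisfies the *cohomology condition* if there are classes $\omega_1,\ldots,\omega_m\in H^1(N,\mathbb{Z})$ whose cup product $\omega_1\smile\cdots\smile\omega_m\in H^m(N,\mathbb{Z})$ is nonzero. Let $M$ be a compact orientable $n$-dimensional manifold with boundary, $n\ge 3$, whose boundary is a disjoint union $\partial M=\Sigma_0\cup S$ of two closed hypersurfaces, where $S$ may be empty and neither $\Sigma_0$ nor $S$ is required to be connected. (A closed hypersurface of $M$ is a compact embedded smooth $(n-1)$-dimensional submanifold without boundary; it may meet $\partial M$ or lie in it.) Suppose that 1. $M$ satisfies the *homotopy condition* with respect to $\Sigma_0$: there is a continuous map $\rho:M\to\Sigma_0$ such that $\rho\circ i:\Sigma_0\to\Sigma_0$ is homotopic to $\mathrm{id}_{\Sigma_0}$, where $i:\Sigma_0\hookrightarrow M$ is the inclusion; 2. $\Sigma_0$ satisfies the cohomology condition (with $m=n-1$). Let $\Sigma$ be any closed hypersurface of $M$, with inclusion $j:\Sigma\hookrightarrow M$, that is homologous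 to $\Sigma_0$ in $M$; that is, $\Sigma$ and $\Sigma_0$ admit orientations whose fundamental classes satisfy $j_*[\Sigma]=i_*[\Sigma_0]$ in $H_{n-1}(M,\mathbb{Z})$. Then $\Sigma$ satisfies the cohomology condition: it is orientable and there are $n-1$ classes in $H^1(\Sigma,\mathbb{Z})$ whose cup product in $H^{n-1}(\Sigma,\mathbb{Z})$ is nonzero. -/

import Mathlib

open CategoryTheory AlgebraicTopology
open scoped Manifold ContDiff

universe u

namespace IntegralCohomology

/-- Integral `k`-cochains on a simplicial set: integer functions on the `k`-simplices, that is,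
homomorphisms from the group of integral `k`-chains to the integers. -/
abbrev Cochain (X : SSet.{u}) (k : ℕ) : Type u :=
  X.obj (Opposite.op (SimplexCategory.mk k)) → ℤ

/-- The coboundary `(d φ)(s) = ∑ i, (-1)^i φ(∂ᵢ s)`. -/
def d (X : SSet.{u}) (k : ℕ) : Cochain X k →ₗ[ℤ] Cochain X (k + 1) where
  toFun φ s := ∑ i : Fin (k + 2), (-1) ^ (i : ℕ) * φ (X.δ i s)
  map_add' φ ψ := by
    funext s
    simp [mul_add, Finset.sum_add_distrib]
  map_smul' c φ := by
    funext s
    simp only [Pi.smul_apply, smul_eq_mul, RingHom.id_apply, Finset.mul_sum]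
    exact Finset.sum_congr rfl fun i _ => by ring

/-- The `k`-cocycles. -/
def cocycles (X : SSet.{u}) (k : ℕ) : Submodule ℤ (Cochain X k) := LinearMap.ker (d X k)

/-- The `k`-coboundaries; the only one in degree `0` is `0`. -/
def coboundaries (X : SSet.{u}) : (k : ℕ) → Submodule ℤ (Cochain X k)
  | 0 => ⊥
  | k + 1 => LinearMap.range (d X k)

/-- The `k`-th integral cohomology group of a simplicial set: cocycles modulo coboundaries. -/
abbrev H (X : SSet.{u}) (k : ℕ) : Type u :=
  cocycles X k ⧸ (coboundaries X k).submoduleOf (cocycles X k)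

section

open scoped Simplicial

/-- The cup product of cochains (Alexander–Whitney formula): evaluate `φ` on the front `p`-face and
`ψ` on the back `q`-face of a `k`-simplex, where `k = p + q`. -/
def cochainCup {X : SSet.{u}} {p q k : ℕ} (h : p + q = k) (φ : Cochain X p) (ψ : Cochain X q) :
    Cochain X k := fun s =>
  φ (X.map (SimplexCategory.subinterval 0 p (by omega) : ⦋p⦌ ⟶ ⦋k⦌).op s) *
    ψ (X.map (SimplexCategory.subinterval p q (by omega) : ⦋q⦌ ⟶ ⦋k⦌).op s)

lemma front_δ_of_lt {p k : ℕ} (hp : p ≤ k) (i : Fin (k + 2)) (hi : p < i) :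
    (SimplexCategory.subinterval 0 p (by omega) : ⦋p⦌ ⟶ ⦋k⦌) ≫ SimplexCategory.δ i =
      SimplexCategory.subinterval 0 p (by omega) := by
  ext l
  have hl : (l : ℕ) < p + 1 := l.2
  change ((i.succAbove ⟨(l : ℕ) + 0, by omega⟩ : Fin (k + 2)) : ℕ) = (l : ℕ) + 0
  simp only [Fin.succAbove, Fin.lt_def, Fin.val_castSucc]
  split_ifs
  · simp
  · omega

lemma front_δ {p k : ℕ} (hp : p ≤ k) (i : Fin (k + 2)) (j : Fin (p + 2))
    (hij : (i : ℕ) = j) :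
    (SimplexCategory.subinterval 0 p (by omega) : ⦋p⦌ ⟶ ⦋k⦌) ≫ SimplexCategory.δ i =
      SimplexCategory.δ j ≫ SimplexCategory.subinterval 0 (p + 1) (by omega) := by
  ext l
  have hl : (l : ℕ) < p + 1 := l.2
  change ((i.succAbove ⟨(l : ℕ) + 0, by omega⟩ : Fin (k + 2)) : ℕ) =
    ((j.succAbove l : Fin (p + 2)) : ℕ) + 0
  simp only [Fin.succAbove, Fin.lt_def, Fin.val_castSucc]
  split_ifs <;> simp <;> omega

lemma back_δ_of_le {p q k : ℕ} (hp : p + q ≤ k) (i : Fin (k + 2)) (hi : (i : ℕ) ≤ p) :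
    (SimplexCategory.subinterval p q hp : ⦋q⦌ ⟶ ⦋k⦌) ≫ SimplexCategory.δ i =
      SimplexCategory.subinterval (p + 1) q (by omega) := by
  ext l
  have hl : (l : ℕ) < q + 1 := l.2
  change ((i.succAbove ⟨(l : ℕ) + p, by omega⟩ : Fin (k + 2)) : ℕ) = (l : ℕ) + (p + 1)
  simp only [Fin.succAbove, Fin.lt_def, Fin.val_castSucc]
  split_ifs <;> simp <;> omega

lemma back_δ {p q k : ℕ} (hp : p + q ≤ k) (i : Fin (k + 2)) (j : Fin (q + 2))
    (hij : (i : ℕ) = p + j) :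
    (SimplexCategory.subinterval p q hp : ⦋q⦌ ⟶ ⦋k⦌) ≫ SimplexCategory.δ i =
      SimplexCategory.δ j ≫ SimplexCategory.subinterval p (q + 1) (by omega) := by
  ext l
  have hl : (l : ℕ) < q + 1 := l.2
  change ((i.succAbove ⟨(l : ℕ) + p, by omega⟩ : Fin (k + 2)) : ℕ) =
    ((j.succAbove l : Fin (q + 2)) : ℕ) + p
  simp only [Fin.succAbove, Fin.lt_def, Fin.val_castSucc]
  split_ifs <;> simp <;> omega

lemma map_δ {X : SSet.{u}} {p k : ℕ} (f : ⦋p⦌ ⟶ ⦋k⦌) (i : Fin (k + 2)) (s : X _⦋k + 1⦌) :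
    X.map f.op (X.δ i s) = X.map (f ≫ SimplexCategory.δ i).op s := by
  simp [SimplicialObject.δ]

lemma δ_map {X : SSet.{u}} {p k : ℕ} (f : ⦋p + 1⦌ ⟶ ⦋k⦌) (i : Fin (p + 2)) (s : X _⦋k⦌) :
    X.δ i (X.map f.op s) = X.map (SimplexCategory.δ i ≫ f).op s := by
  simp [SimplicialObject.δ]

/-- The graded Leibniz rule. -/
lemma d_cochainCup {X : SSet.{u}} {p q k : ℕ} (h : p + q = k) (φ : Cochain X p)
    (ψ : Cochain X q) :
    d X k (cochainCup h φ ψ) =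
      cochainCup (show (p + 1) + q = k + 1 by omega) (d X p φ) ψ +
        (-1 : ℤ) ^ p • cochainCup (show p + (q + 1) = k + 1 by omega) φ (d X q ψ) := by
  funext s
  have e : (p + 1) + (q + 1) = k + 2 := by omega
  simp only [d, LinearMap.coe_mk, AddHom.coe_mk, Pi.add_apply, Pi.smul_apply, smul_eq_mul,
    cochainCup, map_δ, δ_map]
  rw [← (finCongr e).sum_comp, Fin.sum_univ_add, Fin.sum_univ_castSucc (n := p + 1),
    Fin.sum_univ_succ (n := q + 1)]
  have h1 : ∀ i : Fin (p + 1), SimplexCategory.δ (Fin.castSucc i) ≫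
      SimplexCategory.subinterval 0 (p + 1) (by omega) =
      (SimplexCategory.subinterval 0 p (by omega) : ⦋p⦌ ⟶ ⦋k⦌) ≫
        SimplexCategory.δ (finCongr e (Fin.castAdd (q + 1) i)) :=
    fun i => (front_δ (by omega) _ _ (by simp)).symm
  have h2 : ∀ i : Fin (p + 1), (SimplexCategory.subinterval p q (by omega) : ⦋q⦌ ⟶ ⦋k⦌) ≫
      SimplexCategory.δ (finCongr e (Fin.castAdd (q + 1) i)) =
      SimplexCategory.subinterval (p + 1) q (by omega) :=
    fun i => back_δ_of_le _ _ (by have := i.2; simp; omega)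
  have h3 : ∀ j : Fin (q + 1), SimplexCategory.δ (Fin.succ j) ≫
      SimplexCategory.subinterval p (q + 1) (by omega) =
      (SimplexCategory.subinterval p q (by omega) : ⦋q⦌ ⟶ ⦋k⦌) ≫
        SimplexCategory.δ (finCongr e (Fin.natAdd (p + 1) j)) :=
    fun j => (back_δ (by omega) _ _ (by simp; omega)).symm
  have h4 : ∀ j : Fin (q + 1), (SimplexCategory.subinterval 0 p (by omega) : ⦋p⦌ ⟶ ⦋k⦌) ≫
      SimplexCategory.δ (finCongr e (Fin.natAdd (p + 1) j)) =
      SimplexCategory.subinterval 0 p (by omega) :=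
    fun j => front_δ_of_lt (by omega) _ (by simp; omega)
  have h5 : SimplexCategory.δ (Fin.last (p + 1)) ≫
      (SimplexCategory.subinterval 0 (p + 1) (by omega) : ⦋p + 1⦌ ⟶ ⦋k + 1⦌) =
      SimplexCategory.subinterval 0 p (by omega) := by
    rw [← front_δ (k := k) (by omega) ⟨p + 1, by omega⟩ _ (by simp)]
    exact front_δ_of_lt (by omega) _ (by simp)
  have h6 : SimplexCategory.δ (0 : Fin (q + 2)) ≫
      (SimplexCategory.subinterval p (q + 1) (by omega) : ⦋q + 1⦌ ⟶ ⦋k + 1⦌) =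
      SimplexCategory.subinterval (p + 1) q (by omega) := by
    rw [← back_δ (k := k) (by omega) ⟨p, by omega⟩ _ (by simp)]
    exact back_δ_of_le _ _ (by simp)
  simp only [h1, h2, h3, h4, h5, h6, add_mul, mul_add, Finset.sum_mul, Finset.mul_sum]
  have c1 : ∀ i : Fin (p + 1), ((finCongr e (Fin.castAdd (q + 1) i) : Fin (k + 2)) : ℕ) = i :=
    fun i => by simp
  have c2 : ∀ j : Fin (q + 1),
      ((finCongr e (Fin.natAdd (p + 1) j) : Fin (k + 2)) : ℕ) = p + 1 + j :=
    fun j => by simp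
  simp only [c1, c2, Fin.val_castSucc, Fin.val_last, Fin.val_succ, Fin.val_zero]
  have : ∀ a b c b' c' : ℤ, b = b' → c + c' = 0 → a + b = a + c + (c' + b') := by
    intros; linarith
  simp only [mul_assoc]
  refine this _ _ _ _ _ (Finset.sum_congr rfl fun j _ => ?_) ?_
  · rw [pow_add, pow_add, pow_add]; ring
  · ring

end

lemma cochainCup_mem_cocycles {X : SSet.{u}} {p q k : ℕ} (h : p + q = k) {φ : Cochain X p}
    {ψ : Cochain X q} (hφ : φ ∈ cocycles X p) (hψ : ψ ∈ cocycles X q) :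
    cochainCup h φ ψ ∈ cocycles X k := by
  rw [cocycles, LinearMap.mem_ker] at *
  rw [d_cochainCup, hφ, hψ]
  funext s
  simp [cochainCup]

lemma cochainCup_mem_coboundaries_left {X : SSet.{u}} {p q k : ℕ} (h : p + q = k)
    {φ : Cochain X p} {ψ : Cochain X q} (hφ : φ ∈ coboundaries X p) (hψ : ψ ∈ cocycles X q) :
    cochainCup h φ ψ ∈ coboundaries X k := by
  rw [cocycles, LinearMap.mem_ker] at hψ
  cases p with
  | zero =>
    have h0 : φ = 0 := hφ
    have : cochainCup h φ ψ = 0 := by funext s; simp [cochainCup, h0]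
    rw [this]; exact zero_mem _
  | succ p =>
    obtain ⟨χ, rfl⟩ := hφ
    obtain ⟨k, rfl⟩ : ∃ j, k = j + 1 := ⟨p + q, by omega⟩
    refine ⟨cochainCup (by omega) χ ψ, ?_⟩
    rw [d_cochainCup, hψ]
    funext s
    simp [cochainCup]

lemma cochainCup_mem_coboundaries_right {X : SSet.{u}} {p q k : ℕ} (h : p + q = k)
    {φ : Cochain X p} {ψ : Cochain X q} (hφ : φ ∈ cocycles X p) (hψ : ψ ∈ coboundaries X q) :
    cochainCup h φ ψ ∈ coboundaries X k := by
  rw [cocycles, LinearMap.mem_ker] at hφ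
  cases q with
  | zero =>
    have h0 : ψ = 0 := hψ
    have : cochainCup h φ ψ = 0 := by funext s; simp [cochainCup, h0]
    rw [this]; exact zero_mem _
  | succ q =>
    obtain ⟨χ, rfl⟩ := hψ
    obtain ⟨k, rfl⟩ : ∃ j, k = j + 1 := ⟨p + q, by omega⟩
    refine ⟨(-1 : ℤ) ^ p • cochainCup (by omega) φ χ, ?_⟩
    rw [map_smul, d_cochainCup, hφ, smul_add, smul_smul, ← mul_pow]
    funext s
    simp [cochainCup]

/-- The cup product on integral cohomology, given by the cup product of representing cocycles. -/
def cup {X : SSet.{u}} {p q : ℕ} (a : H X p) (b : H X q) : H X (p + q) :=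
  @Quotient.liftOn₂ _ _ _ (Submodule.quotientRel _) (Submodule.quotientRel _) a b
    (fun φ ψ => Submodule.Quotient.mk
      (⟨cochainCup rfl φ.1 ψ.1, cochainCup_mem_cocycles rfl φ.2 ψ.2⟩ : cocycles X (p + q)))
    (by
      intro φ ψ φ' ψ' hφ hψ
      replace hφ := (Submodule.quotientRel_def _).1 hφ
      replace hψ := (Submodule.quotientRel_def _).1 hψ
      have h1 := cochainCup_mem_coboundaries_left rfl (Submodule.mem_comap.1 hφ) ψ.2
      have h2 := cochainCup_mem_coboundaries_right rfl φ'.2 (Submodule.mem_comap.1 hψ)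
      refine (Submodule.Quotient.eq _).2 (Submodule.mem_comap.2 ?_)
      convert add_mem h1 h2 using 1
      funext s
      simp [cochainCup]
      ring)

/-- The unit of the cup product: the class of the cochain with constant value `1`. -/
def one (X : SSet.{u}) : H X 0 :=
  Submodule.Quotient.mk ⟨fun _ => 1, by
    rw [cocycles, LinearMap.mem_ker]
    funext s
    simp [d, Fin.sum_univ_succ]⟩

/-- The cup product `w₁ ⌣ ⋯ ⌣ wₘ` of degree-one classes. -/
def cupProd {X : SSet.{u}} : (m : ℕ) → (Fin m → H X 1) → H X m
  | 0, _ => one X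
  | m + 1, w => cup (cupProd m fun i => w i.castSucc) (w (Fin.last m))

end IntegralCohomology

/-- The `k`-th integral singular cohomology group of a topological space. -/
abbrev SingularCohomology (X : Type u) [TopologicalSpace X] (k : ℕ) : Type u :=
  IntegralCohomology.H (TopCat.toSSet.obj (TopCat.of X)) k

namespace IntegralHomology

/-- The integral singular chain complex of a topological space. -/
noncomputable abbrev chains (X : TopCat.{u}) : ChainComplex (ModuleCat.{u} ℤ) ℕ :=
  ((singularChainComplexFunctor (ModuleCat.{u} ℤ)).obj (ModuleCat.of ℤ (ULift.{u} ℤ))).obj X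

/-- The chain map induced by a continuous map. -/
noncomputable abbrev chainsMap {X Y : TopCat.{u}} (f : X ⟶ Y) : chains X ⟶ chains Y :=
  ((singularChainComplexFunctor (ModuleCat.{u} ℤ)).obj (ModuleCat.of ℤ (ULift.{u} ℤ))).map f

/-- The inclusion of a subspace. -/
def incl {X : Type u} [TopologicalSpace X] (A : Set X) : TopCat.of A ⟶ TopCat.of X :=
  TopCat.ofHom ⟨Subtype.val, continuous_subtype_val⟩

/-- The inclusion of a subspace into a larger subspace. -/
def inclOfLE {X : Type u} [TopologicalSpace X] {A B : Set X} (h : A ⊆ B) :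
    TopCat.of A ⟶ TopCat.of B :=
  TopCat.ofHom ⟨Set.inclusion h, continuous_inclusion h⟩

/-- The relative singular chain complex of the pair `(X, A)`: the quotient of the chains of `X` by
the chains of `A`. -/
noncomputable abbrev relChains {X : Type u} [TopologicalSpace X] (A : Set X) :
    ChainComplex (ModuleCat.{u} ℤ) ℕ :=
  Limits.cokernel (chainsMap (incl A))

/-- The projection of the chains of `X` onto the chains of `(X, A)`. -/
noncomputable abbrev toRelChains {X : Type u} [TopologicalSpace X] (A : Set X) :
    chains (TopCat.of X) ⟶ relChains A :=
  Limits.cokernel.π (chainsMap (incl A))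

lemma chainsMap_incl_toRelChains {X : Type u} [TopologicalSpace X] {A B : Set X} (h : A ⊆ B) :
    chainsMap (incl A) ≫ toRelChains B = 0 := by
  have e : chainsMap (incl A) = chainsMap (inclOfLE h) ≫ chainsMap (incl B) :=
    Functor.map_comp _ (inclOfLE h) (incl B)
  rw [e, Category.assoc, Limits.cokernel.condition, Limits.comp_zero]

/-- The chain map `(X, A) ⟶ (X, B)` for `A ⊆ B`. -/
noncomputable abbrev relChainsOfLE {X : Type u} [TopologicalSpace X] {A B : Set X} (h : A ⊆ B) :
    relChains A ⟶ relChains B :=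
  Limits.cokernel.desc _ (toRelChains B) (chainsMap_incl_toRelChains h)

end IntegralHomology

/-- The `k`-th integral singular homology group of a topological space. -/
noncomputable abbrev SingularHomology (X : Type u) [TopologicalSpace X] (k : ℕ) :
    ModuleCat.{u} ℤ :=
  ((singularHomologyFunctor (ModuleCat.{u} ℤ) k).obj
    (ModuleCat.of ℤ (ULift.{u} ℤ))).obj (TopCat.of X)

open IntegralHomology in
/-- The `k`-th integral singular homology group of the pair `(X, A)`. -/
noncomputable abbrev RelSingularHomology (X : Type u) [TopologicalSpace X] (A : Set X) (k : ℕ) :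
    ModuleCat.{u} ℤ :=
  (relChains A).homology k

namespace IntegralHomology

/-- The push-forward of a homology class of a subspace to the whole space. -/
noncomputable def pushforward {X : Type u} [TopologicalSpace X] (A : Set X) (k : ℕ) :
    SingularHomology A k ⟶ SingularHomology X k :=
  ((singularHomologyFunctor (ModuleCat.{u} ℤ) k).obj
    (ModuleCat.of ℤ (ULift.{u} ℤ))).map (incl A)

/-- The map from absolute to relative homology. -/
noncomputable def toRel {X : Type u} [TopologicalSpace X] (A : Set X) (k : ℕ) :
    SingularHomology X k ⟶ RelSingularHomology X A k :=
  HomologicalComplex.homologyMap (toRelChains A) k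

/-- The restriction `H_k(X, A) ⟶ H_k(X, B)` for `A ⊆ B`. -/
noncomputable def restrict {X : Type u} [TopologicalSpace X] {A B : Set X} (h : A ⊆ B) (k : ℕ) :
    RelSingularHomology X A k ⟶ RelSingularHomology X B k :=
  HomologicalComplex.homologyMap (relChainsOfLE h) k

end IntegralHomology

open IntegralHomology in
/-- A `k`-dimensional manifold `X` without boundary is *orientable* if there is a choice of
generators `μ x` of the local homology groups `H_k(X, X \ {x}; ℤ)` that is locally consistent:
every point has an open neighbourhood `U` such that all `μ y` with `y ∈ U` are the restrictions of
one class in `H_k(X, X \ U; ℤ)`. -/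
def IsOrientable (k : ℕ) (X : Type u) [TopologicalSpace X] : Prop :=
  ∃ μ : ∀ x : X, RelSingularHomology X {x}ᶜ k,
    (∀ x, Submodule.span ℤ {μ x} = ⊤) ∧
    ∀ x, ∃ U : Set X, IsOpen U ∧ x ∈ U ∧ ∃ β : RelSingularHomology X Uᶜ k,
      ∀ (y : X) (hy : y ∈ U),
        restrict (Set.compl_subset_compl.2 (Set.singleton_subset_iff.2 hy)) k β = μ y

open IntegralHomology in
/-- A *fundamental class* of a closed oriented `k`-dimensional manifold `X` (for some orientation):
a class in `H_k(X; ℤ)` that restricts to a generator of `H_k(X, X \ {x}; ℤ)` for every `x`. -/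
def IsFundamentalClass (k : ℕ) (X : Type u) [TopologicalSpace X] (c : SingularHomology X k) :
    Prop :=
  ∀ x : X, Submodule.span ℤ {toRel {x}ᶜ k c} = ⊤

/-- The cohomology condition for a closed `m`-dimensional manifold `N`: it is orientable and there
are `m` integral classes of degree one on `N` with nonzero cup product. -/
def CohomologyCondition (m : ℕ) (N : Type u) [TopologicalSpace N] : Prop :=
  IsOrientable m N ∧
    ∃ w : Fin m → SingularCohomology N 1, IntegralCohomology.cupProd m w ≠ 0

/-- The homotopy condition for `M` with respect to the subspace `A`: there is a continuous map
`ρ : M → A` whose restriction to `A` is homotopic to the identity of `A`. -/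
def HomotopyCondition {M : Type u} [TopologicalSpace M] (A : Set M) : Prop :=
  ∃ ρ : C(M, A), (ρ.comp ⟨Subtype.val, continuous_subtype_val⟩).Homotopic (ContinuousMap.id A)

open IntegralHomology in
/-- The closed `k`-dimensional hypersurfaces `A` and `B` are *homologous* in `M`: they have
orientations for which the images of their fundamental classes in `H_k(M; ℤ)` coincide. -/
def Homologous (k : ℕ) {M : Type u} [TopologicalSpace M] (A B : Set M) : Prop :=
  ∃ (a : SingularHomology A k) (b : SingularHomology B k),
    IsFundamentalClass k A a ∧ IsFundamentalClass k B b ∧ pushforward A k a = pushforward B k b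

/-- A closed (compact without boundary) embedded smooth hypersurface of the smooth `n`-dimensional
manifold with boundary `M`: a compact subset which, with the subspace topology, carries the
structure of a smooth `(n - 1)`-dimensional manifold without boundary for which the inclusion into
`M` is a smooth immersion. It may meet, or be part of, the boundary of `M`. -/
def IsClosedHypersurface (n : ℕ) [NeZero n] {M : Type u} [TopologicalSpace M]
    [ChartedSpace (EuclideanHalfSpace n) M] (A : Set M) : Prop :=
  IsCompact A ∧
    ∃ _ : ChartedSpace (EuclideanSpace ℝ (Fin (n - 1))) A,
      IsManifold (𝓡 (n - 1)) ∞ A ∧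
      ContMDiff (𝓡 (n - 1)) (𝓡∂ n) ∞ (Subtype.val : A → M) ∧
      ∀ x : A, Function.Injective (mfderiv (𝓡 (n - 1)) (𝓡∂ n) (Subtype.val : A → M) x)

/-! Write `A` for Σ, `A₀` for Σ₀, i and j for their inclusions into `M`, and f = ρ ∘ j. Let P be a
nonzero product of degree-one classes on `A₀`. The pullbacks of its factors under f have product
f^*P, so it suffices that f^*P = 0 forces P = 0. Assume f^*P = 0, let C ⊆ `A₀` be clopen, and let
P_C be P on C and zero elsewhere. Then f^*P_C = 0, and since ρ ∘ i ≃ id and i_*[A₀] = j_*[A], ⟨P_C,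
[A₀]⟩ = ⟨ρ^*P_C, i_*[A₀]⟩ = ⟨ρ^*P_C, j_*[A]⟩ = ⟨f^*P_C, [A]⟩ = 0. This is `mem_rb_of_homologous`.
The sets C are needed because `A₀` may be disconnected, so that the pairing of P itself would not
detect it. Orientability of `A` is read off from its fundamental class.

What remains is `mem_rb_of_functional`: on a closed manifold, a top-degree class whose clopen
restrictions all pair to zero with the fundamental class vanishes. Poincaré duality is not used.
Mayer–Vietoris over charts shows that top cohomology is generated by classes supported at points
(`rz_empty_le_iSup_supportedAt`); the obstructions live above the dimension and vanish by
`rz_compl_biUnion_le`. Supports can be moved inside a chart (`supportedAt_le`), hence along a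
component, so on each component P is represented by one cocycle u relative to the complement of a
point x. The fundamental class generates the local homology at x, so u vanishes on all relative
cycles, and such a u is a relative coboundary (`detected_compl_point`).

The homological tools are built on cochains, from natural operators on ordered chains of the
standard simplex. Degrees count vertices: degree `k` means dimension `k - 1`, and degree `0` is the
augmentation by the empty simplex. The empty simplex lies in every set, so relative cochains vanish
in degree `0`, and cohomology relative to `∅` is the unreduced one. -/

/-! ### Ordered chains: cones, fillings and subdivision. -/

namespace OrderedChain

/-- Integral chains on ordered `k`-tuples of points of `P`. -/
abbrev Chain (P : Type*) (k : ℕ) : Type _ := (Fin k → P) →₀ ℤ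

variable {P Q : Type*}

/-- The linear map determined by its values on tuples. -/
noncomputable abbrev lift {k : ℕ} {A : Type*} [AddCommGroup A] (f : (Fin k → P) → A) :
    Chain P k →ₗ[ℤ] A := Finsupp.linearCombination ℤ f

/-- A tuple as a chain. -/
noncomputable abbrev of {k : ℕ} (v : Fin k → P) : Chain P k := Finsupp.single v 1

lemma lift_of {k : ℕ} {A : Type*} [AddCommGroup A] (f : (Fin k → P) → A) (v : Fin k → P) :
    lift f (of v) = f v := by simp

lemma hom_ext {k : ℕ} {A : Type*} [AddCommGroup A] {f g : Chain P k →ₗ[ℤ] A}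
    (h : ∀ v, f (of v) = g (of v)) : f = g :=
  Finsupp.lhom_ext' fun v => LinearMap.ext_ring (h v)

/-- The alternating sum of the faces of a tuple. -/
noncomputable def bd (k : ℕ) : Chain P (k + 1) →ₗ[ℤ] Chain P k :=
  lift fun v => ∑ i : Fin (k + 1), (-1 : ℤ) ^ (i : ℕ) • of (v ∘ i.succAbove)

lemma bd_of {k : ℕ} (v : Fin (k + 1) → P) :
    bd k (of v) = ∑ i : Fin (k + 1), (-1 : ℤ) ^ (i : ℕ) • of (v ∘ i.succAbove) := lift_of _ _

/-- The join with an apex. -/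
noncomputable def cone (a : P) (k : ℕ) : Chain P k →ₗ[ℤ] Chain P (k + 1) :=
  lift fun v => of (Fin.cons a v : Fin (k + 1) → P)

lemma cone_of {k : ℕ} (a : P) (v : Fin k → P) :
    cone a k (of v) = of (Fin.cons a v : Fin (k + 1) → P) := lift_of _ _

lemma bd_cone_zero (a : P) (c : Chain P 0) : bd 0 (cone a 0 c) = c := by
  have : (bd 0).comp (cone a 0) = LinearMap.id := by
    refine hom_ext fun v => ?_
    rw [LinearMap.comp_apply, cone_of, bd_of, Fin.sum_univ_succ, Finset.univ_eq_empty,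
      Finset.sum_empty, add_zero, Fin.val_zero, pow_zero, one_smul, LinearMap.id_apply]
    congr 1
  exact LinearMap.congr_fun this c

/-- Deleting the apex returns the tuple; every other face is the cone over a face, with the sign
shifted by one. So the cone contracts the augmented complex. -/
lemma bd_cone_succ (a : P) {k : ℕ} (c : Chain P (k + 1)) :
    bd (k + 1) (cone a (k + 1) c) = c - cone a k (bd k c) := by
  have : (bd (k + 1)).comp (cone a (k + 1)) = LinearMap.id - (cone a k).comp (bd k) := by
    refine hom_ext fun v => ?_
    rw [LinearMap.comp_apply, cone_of, bd_of, Fin.sum_univ_succ, LinearMap.sub_apply,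
      LinearMap.comp_apply, bd_of, map_sum, sub_eq_add_neg, ← Finset.sum_neg_distrib]
    congr 1
    · simp only [Fin.val_zero, pow_zero, one_smul, LinearMap.id_apply]
      congr 1
    · refine Finset.sum_congr rfl fun i _ => ?_
      rw [map_smul, cone_of, Fin.val_succ, pow_succ, mul_neg_one, neg_smul]
      congr 3
      funext j
      refine Fin.cases ?_ (fun j => ?_) j <;> simp [Fin.succ_succAbove_succ]
  exact LinearMap.congr_fun this c

/-- Every tuple is the cone over its tail, so the cone formula reduces the claim to the tail, one
degree lower. -/
lemma bd_bd {k : ℕ} (c : Chain P (k + 2)) : bd k (bd (k + 1) c) = 0 := by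
  have : (bd k).comp (bd (k + 1)) = (0 : Chain P (k + 2) →ₗ[ℤ] Chain P k) := by
    refine hom_ext fun v => ?_
    rw [← Fin.cons_self_tail v, ← cone_of, LinearMap.comp_apply, bd_cone_succ, map_sub,
      LinearMap.zero_apply]
    cases k with
    | zero => rw [bd_cone_zero, sub_self]
    | succ k =>
      rw [bd_cone_succ]
      have := bd_bd (of (Fin.tail v))
      simp [this]
  exact LinearMap.congr_fun this c

/-- The map of chains induced by a map of points. -/
noncomputable def map (f : P → Q) (k : ℕ) : Chain P k →ₗ[ℤ] Chain Q k :=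
  lift fun v => of (f ∘ v)

lemma map_of (f : P → Q) {k : ℕ} (v : Fin k → P) : map f k (of v) = of (f ∘ v) := lift_of _ _

lemma bd_map (f : P → Q) {k : ℕ} (c : Chain P (k + 1)) :
    bd k (map f (k + 1) c) = map f k (bd k c) := by
  have : (bd k).comp (map f (k + 1)) = (map f k).comp (bd k) := by
    refine hom_ext fun v => ?_
    simp [map_of, bd_of, map_sum, Function.comp_assoc, -Finsupp.smul_single]
  exact LinearMap.congr_fun this c

lemma map_cone (f : P → Q) {k : ℕ} (a : P) (c : Chain P k) :
    map f (k + 1) (cone a k c) = cone (f a) k (map f k c) := by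
  have : (map f (k + 1)).comp (cone a k) = (cone (f a) k).comp (map f k) := by
    refine hom_ext fun v => ?_
    simp only [LinearMap.comp_apply, cone_of, map_of]
    congr 1
    exact Fin.comp_cons f a v
  exact LinearMap.congr_fun this c

/-- The chains all of whose tuples satisfy a predicate. -/
noncomputable abbrev supp {k : ℕ} (p : (Fin k → P) → Prop) : Submodule ℤ (Chain P k) :=
  Finsupp.supported ℤ ℤ {v | p v}

lemma of_mem_supp {k : ℕ} {p : (Fin k → P) → Prop} {v : Fin k → P} (h : p v) : of v ∈ supp p :=
  Finsupp.single_mem_supported ℤ 1 h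

lemma map_mem_of_supp {k : ℕ} {p : (Fin k → P) → Prop} {A : Type*} [AddCommGroup A]
    {f : Chain P k →ₗ[ℤ] A} {S : Submodule ℤ A} (h : ∀ v, p v → f (of v) ∈ S)
    {c : Chain P k} (hc : c ∈ supp p) : f c ∈ S := by
  rw [supp, Finsupp.supported_eq_span_single] at hc
  have : Submodule.span ℤ ((fun v => Finsupp.single v (1 : ℤ)) '' {v | p v}) ≤ S.comap f := by
    rw [Submodule.span_le]
    rintro _ ⟨v, hv, rfl⟩
    exact h v hv
  exact this hc

/-- The chain operator of degree one defined recursively by coning the defect of the homotopy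
identity: a chain homotopy between `0` and `F`. -/
noncomputable def fill (F : ∀ k, Chain P k →ₗ[ℤ] Chain Q k) (a : ∀ k, (Fin (k + 1) → P) → Q) :
    ∀ k, Chain P k →ₗ[ℤ] Chain Q (k + 1)
  | 0 => 0
  | k + 1 => lift fun v => cone (a k v) (k + 1) (F (k + 1) (of v) - fill F a k (bd k (of v)))

lemma fill_of (F : ∀ k, Chain P k →ₗ[ℤ] Chain Q k) (a : ∀ k, (Fin (k + 1) → P) → Q) {k : ℕ}
    (v : Fin (k + 1) → P) : fill F a (k + 1) (of v) =
      cone (a k v) (k + 1) (F (k + 1) (of v) - fill F a k (bd k (of v))) := lift_of _ _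

/-- The defect `F - fill ∘ bd` is itself a cycle, by the identity one degree lower, so coning it
produces no correction term. `F 0 = 0` starts the induction. -/
lemma bd_fill {F : ∀ k, Chain P k →ₗ[ℤ] Chain Q k} (a : ∀ k, (Fin (k + 1) → P) → Q)
    (h0 : F 0 = 0) (hF : ∀ k c, bd k (F (k + 1) c) = F k (bd k c)) {k : ℕ} (c : Chain P (k + 1)) :
    bd (k + 1) (fill F a (k + 1) c) = F (k + 1) c - fill F a k (bd k c) := by
  have : (bd (k + 1)).comp (fill F a (k + 1)) = F (k + 1) - (fill F a k).comp (bd k) := by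
    refine hom_ext fun v => ?_
    rw [LinearMap.comp_apply, fill_of, bd_cone_succ, LinearMap.sub_apply, LinearMap.comp_apply,
      map_sub, hF, sub_eq_self]
    cases k with
    | zero => simp [h0, fill]
    | succ k => rw [bd_fill a h0 hF, bd_bd]; simp
  exact LinearMap.congr_fun this c

/-- Naturality of the apexes and of `F` is all that the recursion uses. Both the subdivision
homotopy and the prism are instances, and their naturality is what transfers them to singular
simplices. -/
lemma map_fill {P' Q' : Type*} {F : ∀ k, Chain P k →ₗ[ℤ] Chain Q k}
    {F' : ∀ k, Chain P' k →ₗ[ℤ] Chain Q' k} {a : ∀ k, (Fin (k + 1) → P) → Q}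
    {a' : ∀ k, (Fin (k + 1) → P') → Q'} (f : P → P') (g : Q → Q')
    (hF : ∀ k c, map g k (F k c) = F' k (map f k c))
    (ha : ∀ k v, g (a k v) = a' k (f ∘ v)) (k : ℕ) (c : Chain P k) :
    map g (k + 1) (fill F a k c) = fill F' a' k (map f k c) := by
  induction k with
  | zero => simp [fill]
  | succ k ih =>
    have : (map g (k + 2)).comp (fill F a (k + 1)) =
        (fill F' a' (k + 1)).comp (map f (k + 1)) := by
      refine hom_ext fun v => ?_
      rw [LinearMap.comp_apply, LinearMap.comp_apply, fill_of, map_cone, map_sub, hF, ih, map_of,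
        fill_of, ha, ← map_of f v, bd_map]
    exact LinearMap.congr_fun this c

/-- The iterated subdivision of ordered chains with the apexes `b`. -/
noncomputable def sd (b : ∀ k, (Fin (k + 1) → P) → P) : ∀ k, Chain P k →ₗ[ℤ] Chain P k
  | 0 => LinearMap.id
  | k + 1 => lift fun v => cone (b k v) k (sd b k (bd k (of v)))

variable (b : ∀ k, (Fin (k + 1) → P) → P)

lemma sd_of {k : ℕ} (v : Fin (k + 1) → P) :
    sd b (k + 1) (of v) = cone (b k v) k (sd b k (bd k (of v))) := lift_of _ _

lemma bd_sd {k : ℕ} (c : Chain P (k + 1)) : bd k (sd b (k + 1) c) = sd b k (bd k c) := by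
  have : (bd k).comp (sd b (k + 1)) = (sd b k).comp (bd k) := by
    refine hom_ext fun v => ?_
    rw [LinearMap.comp_apply, LinearMap.comp_apply, sd_of]
    cases k with
    | zero => rw [bd_cone_zero]
    | succ k => rw [bd_cone_succ, bd_sd, bd_bd]; simp
  exact LinearMap.congr_fun this c

lemma map_sd {b' : ∀ k, (Fin (k + 1) → Q) → Q} (f : P → Q)
    (hb : ∀ k v, f (b k v) = b' k (f ∘ v)) (k : ℕ) (c : Chain P k) :
    map f k (sd b k c) = sd b' k (map f k c) := by
  induction k with
  | zero => simp [sd]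
  | succ k ih =>
    have : (map f (k + 1)).comp (sd b (k + 1)) = (sd b' (k + 1)).comp (map f (k + 1)) := by
      refine hom_ext fun v => ?_
      rw [LinearMap.comp_apply, LinearMap.comp_apply, sd_of, map_cone, ih, map_of, sd_of, hb,
        ← map_of f v, bd_map]
    exact LinearMap.congr_fun this c

/-- The chain homotopy from the identity to the subdivision. -/
noncomputable def sdHomotopy : ∀ k, Chain P k →ₗ[ℤ] Chain P (k + 1) :=
  fill (fun k => LinearMap.id - sd b k) b

lemma bd_sdHomotopy {k : ℕ} (c : Chain P (k + 1)) :
    bd (k + 1) (sdHomotopy b (k + 1) c) =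
      c - sd b (k + 1) c - sdHomotopy b k (bd k c) :=
  bd_fill b (by simp [sd]) (fun k c => by simp [bd_sd]) c

lemma map_sdHomotopy {b' : ∀ k, (Fin (k + 1) → Q) → Q} (f : P → Q)
    (hb : ∀ k v, f (b k v) = b' k (f ∘ v)) (k : ℕ) (c : Chain P k) :
    map f (k + 1) (sdHomotopy b k c) = sdHomotopy b' k (map f k c) :=
  map_fill f f (fun k c => by simp [map_sd b f hb]) hb k c

end OrderedChain

/-! ### Convex combinations and affine maps. -/

namespace OrderedChain

/-- The map of standard simplices induced by a map of vertices, as a continuous map. -/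
noncomputable def simplexMap {k l : ℕ} (f : Fin k → Fin l) :
    C(stdSimplex ℝ (Fin k), stdSimplex ℝ (Fin l)) :=
  ⟨stdSimplex.map f, stdSimplex.continuous_map f⟩

lemma sum_simplexMap_smul {k l : ℕ} (f : Fin k → Fin l) {E : Type*} [AddCommGroup E] [Module ℝ E]
    (t : stdSimplex ℝ (Fin k)) (v : Fin l → E) :
    ∑ j, (simplexMap f t) j • v j = ∑ i, t i • v (f i) := by
  classical
  have h : ∀ j, (simplexMap f t) j = ∑ i with f i = j, t i := fun j => by
    change FunOnFinite.linearMap ℝ ℝ f t j = _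
    rw [FunOnFinite.linearMap_apply_apply]
  simp only [h, Finset.sum_smul]
  rw [← Finset.sum_fiberwise Finset.univ f (fun i => t i • v (f i))]
  refine Finset.sum_congr rfl fun j _ => Finset.sum_congr rfl fun i hi => ?_
  rw [(Finset.mem_filter.1 hi).2]

/-- Spaces in which finite tuples of points have convex combinations. -/
class ConvexComb (P : Type*) [TopologicalSpace P] where
  /-- The affine simplex spanned by a tuple. -/
  comb {k : ℕ} (v : Fin k → P) : C(stdSimplex ℝ (Fin k), P)
  comb_comp {k l : ℕ} (v : Fin l → P) (f : Fin k → Fin l) :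
    comb (v ∘ f) = (comb v).comp (simplexMap f)

open ConvexComb

noncomputable instance (n : ℕ) : ConvexComb (stdSimplex ℝ (Fin n)) where
  comb {k} v :=
    ⟨fun t => ⟨∑ i, t i • (v i : Fin n → ℝ),
      (convex_stdSimplex ℝ (Fin n)).sum_mem (fun i _ => t.2.1 i) t.2.2 fun i _ => (v i).2⟩, by
      refine Continuous.subtype_mk (continuous_finsetSum _ fun i _ => ?_) _
      exact ((continuous_apply i).comp continuous_subtype_val).smul continuous_const⟩
  comb_comp v f := by
    ext t
    exact congrFun (sum_simplexMap_smul f t fun j => (v j : Fin n → ℝ)).symm _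

lemma coe_comb {n k : ℕ} (v : Fin k → stdSimplex ℝ (Fin n)) (t : stdSimplex ℝ (Fin k)) :
    (comb v t : Fin n → ℝ) = ∑ i, t i • (v i : Fin n → ℝ) := rfl

instance {P Q : Type*} [TopologicalSpace P] [TopologicalSpace Q] [ConvexComb P] [ConvexComb Q] :
    ConvexComb (P × Q) where
  comb v := (comb (Prod.fst ∘ v)).prodMk (comb (Prod.snd ∘ v))
  comb_comp v f := by
    rw [← Function.comp_assoc, ← Function.comp_assoc, comb_comp, comb_comp]
    rfl

lemma comb_vertex {k l : ℕ} (f : Fin k → Fin l) :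
    comb (fun i => stdSimplex.vertex (S := ℝ) (f i)) = simplexMap f := by
  ext t j
  have := congrFun (sum_simplexMap_smul f t fun j => (Pi.single j 1 : Fin l → ℝ)) j
  change (∑ i, t i • (Pi.single (f i) 1 : Fin l → ℝ)) j = _
  rw [← this, Finset.sum_apply]
  simp [Pi.single_apply]

lemma simplexMap_id (k : ℕ) : simplexMap (id : Fin k → Fin k) = ContinuousMap.id _ :=
  ContinuousMap.ext fun t => stdSimplex.map_id_apply t

/-- Maps preserving convex combinations. -/
def IsAffine {P Q : Type*} [TopologicalSpace P] [TopologicalSpace Q] [ConvexComb P] [ConvexComb Q]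
    (f : C(P, Q)) : Prop := ∀ {k : ℕ} (v : Fin k → P), f.comp (comb v) = comb (f ∘ v)

lemma isAffine_simplexMap {k l : ℕ} (f : Fin k → Fin l) : IsAffine (simplexMap f) := by
  intro n v
  ext t j
  have h : ∀ s : stdSimplex ℝ (Fin k), (simplexMap f s : Fin l → ℝ) =
      FunOnFinite.linearMap ℝ ℝ f (s : Fin k → ℝ) := fun _ => rfl
  change (simplexMap f (comb v t) : Fin l → ℝ) j = (comb (simplexMap f ∘ v) t : Fin l → ℝ) j
  rw [h, coe_comb, coe_comb, map_sum]
  simp only [map_smul]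
  rfl

/-- The barycenter of a tuple. -/
noncomputable def bary {P : Type*} [TopologicalSpace P] [ConvexComb P] (k : ℕ)
    (v : Fin (k + 1) → P) : P := comb v stdSimplex.barycenter

lemma IsAffine.map_bary {P Q : Type*} [TopologicalSpace P] [TopologicalSpace Q] [ConvexComb P]
    [ConvexComb Q] {f : C(P, Q)} (hf : IsAffine f) (k : ℕ) (v : Fin (k + 1) → P) :
    f (bary k v) = bary k (f ∘ v) :=
  DFunLike.congr_fun (hf v) _

end OrderedChain

/-! ### Singular chains carried by ordered chains. -/

namespace SingularChain

open OrderedChain ConvexComb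

/-- Integral singular chains on affine simplices with `k` vertices. -/
abbrev Chain (X : Type*) [TopologicalSpace X] (k : ℕ) : Type _ := C(stdSimplex ℝ (Fin k), X) →₀ ℤ

variable {X Y P Q : Type*} [TopologicalSpace X] [TopologicalSpace Y] [TopologicalSpace P]
  [TopologicalSpace Q] [ConvexComb P] [ConvexComb Q]

/-- The `i`-th face of a singular simplex. -/
noncomputable def face {k : ℕ} (σ : C(stdSimplex ℝ (Fin (k + 1)), X)) (i : Fin (k + 1)) :
    C(stdSimplex ℝ (Fin k), X) := σ.comp (simplexMap i.succAbove)

lemma range_face_subset {k : ℕ} (σ : C(stdSimplex ℝ (Fin (k + 1)), X)) (i : Fin (k + 1)) :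
    Set.range (face σ i) ⊆ Set.range σ := by
  rintro _ ⟨t, rfl⟩
  exact ⟨_, rfl⟩

/-- A singular simplex as a chain. -/
noncomputable abbrev of {k : ℕ} (σ : C(stdSimplex ℝ (Fin k), X)) : Chain X k := Finsupp.single σ 1

lemma hom_ext {k : ℕ} {A : Type*} [AddCommGroup A] {f g : Chain X k →ₗ[ℤ] A}
    (h : ∀ σ, f (of σ) = g (of σ)) : f = g :=
  Finsupp.lhom_ext' fun v => LinearMap.ext_ring (h v)

/-- The linear map determined by its values on singular simplices. -/
noncomputable abbrev lift {k : ℕ} {A : Type*} [AddCommGroup A]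
    (f : C(stdSimplex ℝ (Fin k), X) → A) : Chain X k →ₗ[ℤ] A := Finsupp.linearCombination ℤ f

lemma lift_of {k : ℕ} {A : Type*} [AddCommGroup A] (f : C(stdSimplex ℝ (Fin k), X) → A)
    (σ : C(stdSimplex ℝ (Fin k), X)) : lift f (of σ) = f σ := by simp

/-- The singular boundary. -/
noncomputable def bd (k : ℕ) : Chain X (k + 1) →ₗ[ℤ] Chain X k :=
  lift fun σ => ∑ i : Fin (k + 1), (-1 : ℤ) ^ (i : ℕ) • of (face σ i)

lemma bd_of {k : ℕ} (σ : C(stdSimplex ℝ (Fin (k + 1)), X)) :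
    bd k (of σ) = ∑ i : Fin (k + 1), (-1 : ℤ) ^ (i : ℕ) • of (face σ i) := lift_of _ _

/-- The singular chain carried by a map from a space with convex combinations. -/
noncomputable def real (g : C(P, X)) (k : ℕ) : OrderedChain.Chain P k →ₗ[ℤ] Chain X k :=
  OrderedChain.lift fun v => of (g.comp (comb v))

lemma real_of (g : C(P, X)) {k : ℕ} (v : Fin k → P) :
    real g k (OrderedChain.of v) = of (g.comp (comb v)) := OrderedChain.lift_of _ _

lemma bd_real (g : C(P, X)) {k : ℕ} (c : OrderedChain.Chain P (k + 1)) :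
    bd k (real g (k + 1) c) = real g k (OrderedChain.bd k c) := by
  have : (bd k).comp (real g (k + 1)) = (real g k).comp (OrderedChain.bd k) := by
    refine OrderedChain.hom_ext fun v => ?_
    rw [LinearMap.comp_apply, LinearMap.comp_apply, real_of, bd_of, OrderedChain.bd_of, map_sum]
    refine Finset.sum_congr rfl fun i _ => ?_
    rw [map_smul, real_of, comb_comp]
    rfl
  exact LinearMap.congr_fun this c

lemma real_comp (g : C(Q, X)) {f : C(P, Q)} (hf : IsAffine f) {k : ℕ}
    (c : OrderedChain.Chain P k) :
    real (g.comp f) k c = real g k (OrderedChain.map f k c) := by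
  have : real (g.comp f) k = (real g k).comp (OrderedChain.map f k) := by
    refine OrderedChain.hom_ext fun v => ?_
    rw [LinearMap.comp_apply, real_of, map_of, real_of, ← hf v]
    rfl
  exact LinearMap.congr_fun this c

/-- The tautological tuple of vertices of the standard simplex. -/
noncomputable def taut (k : ℕ) : Fin k → stdSimplex ℝ (Fin k) := fun i => stdSimplex.vertex i

lemma comb_taut (k : ℕ) : comb (taut k) = ContinuousMap.id _ := by
  rw [← simplexMap_id]; exact comb_vertex id

/-- Each singular simplex is thus carried by the tautological tuple, so an operator on ordered
chains of standard simplices acts on singular chains. -/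
lemma real_taut {k : ℕ} (σ : C(stdSimplex ℝ (Fin k), X)) :
    real σ k (OrderedChain.of (taut k)) = of σ := by
  rw [real_of, comb_taut, ContinuousMap.comp_id]

lemma taut_comp {k l : ℕ} (f : Fin k → Fin l) : taut l ∘ f = simplexMap f ∘ taut k := by
  funext i
  exact (stdSimplex.map_vertex f i).symm

/-- Chains supported on simplices with a given property. -/
noncomputable abbrev supp {k : ℕ} (p : C(stdSimplex ℝ (Fin k), X) → Prop) :
    Submodule ℤ (Chain X k) := Finsupp.supported ℤ ℤ {σ | p σ}

lemma of_mem_supp {k : ℕ} {p : C(stdSimplex ℝ (Fin k), X) → Prop}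
    {σ : C(stdSimplex ℝ (Fin k), X)} (h : p σ) : of σ ∈ supp p :=
  Finsupp.single_mem_supported ℤ 1 h

lemma map_mem_of_supp {k : ℕ} {p : C(stdSimplex ℝ (Fin k), X) → Prop} {A : Type*}
    [AddCommGroup A] {f : Chain X k →ₗ[ℤ] A} {S : Submodule ℤ A} (h : ∀ v, p v → f (of v) ∈ S)
    {c : Chain X k} (hc : c ∈ supp p) : f c ∈ S := by
  rw [supp, Finsupp.supported_eq_span_single] at hc
  have : Submodule.span ℤ ((fun v => Finsupp.single v (1 : ℤ)) '' {v | p v}) ≤ S.comap f := by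
    rw [Submodule.span_le]
    rintro _ ⟨v, hv, rfl⟩
    exact h v hv
  exact this hc

lemma supp_mono {k : ℕ} {p q : C(stdSimplex ℝ (Fin k), X) → Prop} (h : ∀ σ, p σ → q σ) :
    supp p ≤ supp q := Finsupp.supported_mono h

lemma real_mem_range (g : C(P, X)) {k : ℕ} (c : OrderedChain.Chain P k) :
    real g k c ∈ supp fun τ => Set.range τ ⊆ Set.range g := by
  have hc : c ∈ OrderedChain.supp fun _ : Fin k → P => True := by
    simp [OrderedChain.supp]
  refine OrderedChain.map_mem_of_supp (fun v _ => ?_) hc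
  rw [real_of]
  refine of_mem_supp ?_
  rintro _ ⟨t, rfl⟩
  exact ⟨_, rfl⟩

/-- The singular chains obtained by applying an operator on ordered chains of the standard simplex
to the tautological tuple assemble to an operator compatible with the passage to faces. -/
lemma sum_real_face {j : ℕ → ℕ}
    (G : ∀ n k, OrderedChain.Chain (stdSimplex ℝ (Fin n)) k →ₗ[ℤ]
      OrderedChain.Chain (stdSimplex ℝ (Fin n)) (j k))
    (hG : ∀ {n n'} (f : Fin n → Fin n') k c, OrderedChain.map (simplexMap f) (j k) (G n k c) =
      G n' k (OrderedChain.map (simplexMap f) k c)) {k : ℕ}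
    (σ : C(stdSimplex ℝ (Fin (k + 1)), X)) :
    real σ (j k) (G (k + 1) k (OrderedChain.bd k (OrderedChain.of (taut (k + 1))))) =
      ∑ i : Fin (k + 1), (-1 : ℤ) ^ (i : ℕ) •
        real (face σ i) (j k) (G k k (OrderedChain.of (taut k))) := by
  rw [OrderedChain.bd_of, map_sum, map_sum]
  refine Finset.sum_congr rfl fun i _ => ?_
  rw [map_smul, map_smul, face, real_comp _ (isAffine_simplexMap _), hG, map_of, taut_comp]

end SingularChain

/-! ### Mesh estimates for barycentric subdivision. -/

namespace OrderedChain

open ConvexComb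

variable {n : ℕ}

/-- The convex hull of the points of a tuple. -/
def hull {k : ℕ} (v : Fin k → stdSimplex ℝ (Fin n)) : Set (stdSimplex ℝ (Fin n)) :=
  {x | (x : Fin n → ℝ) ∈ convexHull ℝ (Set.range fun i => (v i : Fin n → ℝ))}

/-- All mutual distances of the points of the tuple are at most `D`. -/
def Fine (D : ℝ) {k : ℕ} (v : Fin k → stdSimplex ℝ (Fin n)) : Prop :=
  ∀ i j, dist (v i) (v j) ≤ D

lemma mem_hull {k : ℕ} (v : Fin k → stdSimplex ℝ (Fin n)) (i : Fin k) : v i ∈ hull v :=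
  subset_convexHull ℝ _ ⟨i, rfl⟩

lemma comb_mem_hull {k : ℕ} (v : Fin k → stdSimplex ℝ (Fin n)) (t : stdSimplex ℝ (Fin k)) :
    comb v t ∈ hull v := by
  change (comb v t : Fin n → ℝ) ∈ convexHull ℝ (Set.range fun i => (v i : Fin n → ℝ))
  rw [coe_comb]
  exact (convex_convexHull ℝ _).sum_mem (fun i _ => t.2.1 i) t.2.2
    fun i _ => subset_convexHull ℝ _ ⟨i, rfl⟩

lemma hull_comp_subset {k l : ℕ} (v : Fin k → stdSimplex ℝ (Fin n)) (f : Fin l → Fin k) :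
    hull (v ∘ f) ⊆ hull v := fun _ hx => by
  refine convexHull_mono ?_ hx
  rintro _ ⟨i, rfl⟩
  exact ⟨f i, rfl⟩

lemma dist_le_of_mem_hull {k : ℕ} {v : Fin k → stdSimplex ℝ (Fin n)} {D : ℝ}
    {x y : stdSimplex ℝ (Fin n)} (h : ∀ i, dist x (v i) ≤ D) (hy : y ∈ hull v) : dist x y ≤ D := by
  have : convexHull ℝ (Set.range fun i => (v i : Fin n → ℝ)) ⊆
      Metric.closedBall (x : Fin n → ℝ) D := by
    refine convexHull_min ?_ (convex_closedBall _ _)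
    rintro _ ⟨i, rfl⟩
    rw [Metric.mem_closedBall, dist_comm]
    exact h i
  have := this hy
  rw [Metric.mem_closedBall, dist_comm] at this
  exact this

lemma Fine.dist_le_of_mem_hull {k : ℕ} {v : Fin k → stdSimplex ℝ (Fin n)} {D : ℝ} (h : Fine D v)
    {x y : stdSimplex ℝ (Fin n)} (hx : x ∈ hull v) (hy : y ∈ hull v) : dist x y ≤ D := by
  refine OrderedChain.dist_le_of_mem_hull (fun i => ?_) hy
  rw [dist_comm]
  exact OrderedChain.dist_le_of_mem_hull (h i) hx

/-- The difference between barycenter and vertex is `1 / (k + 1)` times a sum of `k` differences of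
vertices, since the term `i = j` drops out. -/
lemma Fine.dist_bary_le {k : ℕ} {v : Fin (k + 1) → stdSimplex ℝ (Fin n)} {D : ℝ} (h : Fine D v)
    (j : Fin (k + 1)) : dist (bary k v) (v j) ≤ k / (k + 1) * D := by
  have hD : 0 ≤ D := dist_nonneg.trans (h j j)
  have hk : (0 : ℝ) < k + 1 := by positivity
  change dist ((bary k v : stdSimplex ℝ (Fin n)) : Fin n → ℝ) (v j : Fin n → ℝ) ≤ _
  have hb : ((bary k v : stdSimplex ℝ (Fin n)) : Fin n → ℝ) = ∑ i, ((k : ℝ) + 1)⁻¹ • (v i : Fin n → ℝ) := by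
    rw [bary, coe_comb]
    refine Finset.sum_congr rfl fun i _ => ?_
    congr 1
    refine (stdSimplex.barycenter_apply i).trans ?_
    simp
  have hs : ((bary k v : stdSimplex ℝ (Fin n)) : Fin n → ℝ) - v j =
      ((k : ℝ) + 1)⁻¹ • ∑ i ∈ Finset.univ.erase j, ((v i : Fin n → ℝ) - v j) := by
    have h1 : ∑ i ∈ Finset.univ.erase j, ((v i : Fin n → ℝ) - v j) =
        ∑ i, ((v i : Fin n → ℝ) - v j) := Finset.sum_erase _ (sub_self _)
    rw [hb, h1, Finset.sum_sub_distrib, ← Finset.smul_sum, smul_sub, Finset.sum_const,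
      Finset.card_univ, Fintype.card_fin, ← Nat.cast_smul_eq_nsmul ℝ, smul_smul]
    push_cast
    rw [inv_mul_cancel₀ hk.ne', one_smul]
  rw [dist_eq_norm]
  change ‖((bary k v : stdSimplex ℝ (Fin n)) : Fin n → ℝ) - (v j : Fin n → ℝ)‖ ≤ _
  rw [hs, norm_smul, norm_inv, Real.norm_of_nonneg hk.le, div_mul_eq_mul_div,
    div_eq_inv_mul]
  refine mul_le_mul_of_nonneg_left ?_ (by positivity)
  refine (norm_sum_le_of_le _ (f := fun i => (v i : Fin n → ℝ) - v j) (n := fun _ => D)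
    fun i _ => ?_).trans ?_
  · rw [← dist_eq_norm]; exact h i j
  · rw [Finset.sum_const, Finset.card_erase_of_mem (Finset.mem_univ j), Finset.card_univ,
      Fintype.card_fin, nsmul_eq_mul]
    simp

lemma supp_mono {P : Type*} {k : ℕ} {p q : (Fin k → P) → Prop} (h : ∀ v, p v → q v) :
    supp p ≤ supp q := Finsupp.supported_mono h

/-- Two vertices of a subdivided simplex either both lie in a subdivided face, where the induction
applies because `(k - 1) / k` increases with `k`, or one is the barycenter, whose distance to the
hull is controlled at the vertices. -/
lemma sd_of_mem {k : ℕ} {D : ℝ} (v : Fin k → stdSimplex ℝ (Fin n)) (h : Fine D v) :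
    sd bary k (of v) ∈
      supp fun w : Fin k → _ => (∀ i, w i ∈ hull v) ∧ Fine (((k : ℝ) - 1) / k * D) w := by
  induction k with
  -- The factor is the default value `-1 / 0 = 0` here, harmless because the tuple is empty.
  | zero => exact of_mem_supp ⟨fun i => i.elim0, fun i => i.elim0⟩
  | succ k ih =>
    have hD : 0 ≤ D := dist_nonneg.trans (h 0 0)
    rw [sd_of, bd_of, map_sum, map_sum]
    refine Submodule.sum_mem _ fun i _ => ?_
    rw [map_smul, map_smul]
    refine Submodule.smul_mem _ _ (map_mem_of_supp (fun w hw => ?_)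
      (ih (v ∘ i.succAbove) fun i j => h _ _))
    rw [cone_of]
    obtain ⟨hw, hf⟩ := hw
    have hw' : ∀ i, w i ∈ hull v := fun i => hull_comp_subset _ _ (hw i)
    have hb : ∀ i, dist (bary k v) (w i) ≤ ((k + 1 : ℕ) - 1 : ℝ) / (k + 1 : ℕ) * D := fun i => by
      push_cast
      rw [add_sub_cancel_right]
      exact dist_le_of_mem_hull h.dist_bary_le (hw' i)
    refine of_mem_supp ⟨fun i => ?_, fun i j => ?_⟩
    · induction i using Fin.cases with
      | zero => exact comb_mem_hull _ _
      | succ i => simpa using hw' i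
    · induction i using Fin.cases with
      | zero =>
        induction j using Fin.cases with
        | zero =>
          simp only [Fin.cons_zero, dist_self]
          push_cast
          rw [add_sub_cancel_right]
          positivity
        | succ j => simpa using hb j
      | succ i =>
        induction j using Fin.cases with
        | zero => rw [dist_comm]; simpa using hb i
        | succ j =>
          simp only [Fin.cons_succ]
          refine (hf i j).trans (mul_le_mul_of_nonneg_right ?_ hD)
          have hk : (0 : ℝ) < k := by
            have : 0 < k := i.pos
            exact_mod_cast this
          push_cast
          rw [div_le_div_iff₀ hk (by positivity)]
          nlinarith

lemma fill_of_mem_hull {F : ∀ k, Chain (stdSimplex ℝ (Fin n)) k →ₗ[ℤ] Chain _ k}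
    (hF : ∀ k (v : Fin k → stdSimplex ℝ (Fin n)),
      F k (of v) ∈ supp fun w : Fin k → stdSimplex ℝ (Fin n) => ∀ i, w i ∈ hull v) {k : ℕ}
    (v : Fin k → stdSimplex ℝ (Fin n)) :
    fill F bary k (of v) ∈ supp fun w : Fin (k + 1) → _ => ∀ i, w i ∈ hull v := by
  induction k with
  | zero => simp [fill]
  | succ k ih =>
    rw [fill_of]
    have : F (k + 1) (of v) - fill F bary k (bd k (of v)) ∈
        supp fun w : Fin (k + 1) → _ => ∀ i, w i ∈ hull v := by
      refine Submodule.sub_mem _ (hF _ v) ?_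
      rw [bd_of, map_sum]
      refine Submodule.sum_mem _ fun i _ => ?_
      rw [map_smul]
      exact Submodule.smul_mem _ _
        (supp_mono (fun w hw j => hull_comp_subset _ _ (hw j)) (ih (v ∘ i.succAbove)))
    refine map_mem_of_supp (fun w hw => ?_) this
    rw [cone_of]
    refine of_mem_supp fun i => ?_
    induction i using Fin.cases with
    | zero => exact comb_mem_hull _ _
    | succ i => simpa using hw i

/-- The homotopy need not shrink the mesh; it stays in the hull, whose diameter is bounded by that
of the vertices. -/
lemma sdHomotopy_of_mem {k : ℕ} {D : ℝ} (v : Fin k → stdSimplex ℝ (Fin n)) (h : Fine D v) :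
    sdHomotopy bary k (of v) ∈ supp fun w : Fin (k + 1) → stdSimplex ℝ (Fin n) => Fine D w := by
  refine supp_mono (fun w hw i j => h.dist_le_of_mem_hull (hw i) (hw j))
    (fill_of_mem_hull (fun k v => ?_) v)
  refine Submodule.sub_mem _ (of_mem_supp (mem_hull v)) ?_
  -- Any bound will do: only the hull part of `sd_of_mem` is used below.
  have hv : Fine (∑ i, ∑ j, dist (v i) (v j)) v := fun i j =>
    (Finset.single_le_sum (f := fun j => dist (v i) (v j)) (fun _ _ => dist_nonneg)
      (Finset.mem_univ j)).trans (Finset.single_le_sum (f := fun i => ∑ j, dist (v i) (v j))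
      (fun _ _ => Finset.sum_nonneg fun _ _ => dist_nonneg) (Finset.mem_univ i))
  exact supp_mono (fun w hw => hw.1) (sd_of_mem v hv)

/-- The iterated barycentric subdivision. -/
noncomputable def sdIter (i n k : ℕ) :
    Chain (stdSimplex ℝ (Fin n)) k →ₗ[ℤ] Chain (stdSimplex ℝ (Fin n)) k := (sd bary k) ^ i

lemma sdIter_zero (n k : ℕ) (c) : sdIter 0 n k c = c := rfl

lemma sdIter_succ (i n k : ℕ) (c) : sdIter (i + 1) n k c = sd bary k (sdIter i n k c) := by
  rw [sdIter, pow_succ']; rfl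

lemma bd_sdIter (i : ℕ) {k : ℕ} (c : Chain (stdSimplex ℝ (Fin n)) (k + 1)) :
    bd k (sdIter i n (k + 1) c) = sdIter i n k (bd k c) := by
  induction i with
  | zero => rfl
  | succ i ih => rw [sdIter_succ, sdIter_succ, bd_sd, ih]

lemma map_sdIter (i : ℕ) {n' : ℕ} (f : Fin n → Fin n') (k : ℕ)
    (c : Chain (stdSimplex ℝ (Fin n)) k) :
    map (simplexMap f) k (sdIter i n k c) = sdIter i n' k (map (simplexMap f) k c) := by
  induction i with
  | zero => rfl
  | succ i ih =>
    rw [sdIter_succ, sdIter_succ, map_sd _ _ (IsAffine.map_bary (isAffine_simplexMap f)), ih]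

lemma sdIter_mem {k : ℕ} {D : ℝ} (i : ℕ) {c : Chain (stdSimplex ℝ (Fin n)) k}
    (hc : c ∈ supp fun w : Fin k → _ => Fine D w) :
    sdIter i n k c ∈ supp fun w : Fin k → _ => Fine ((((k : ℝ) - 1) / k) ^ i * D) w := by
  induction i with
  | zero => simpa [sdIter_zero] using hc
  | succ i ih =>
    rw [sdIter_succ]
    refine map_mem_of_supp (fun w hw => ?_) ih
    rw [pow_succ', mul_assoc]
    exact supp_mono (fun w hw => hw.2) (sd_of_mem w hw)

/-- The homotopy operator applied to an iterated subdivision. -/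
noncomputable def sdIterHomotopy (i n k : ℕ) :
    Chain (stdSimplex ℝ (Fin n)) k →ₗ[ℤ] Chain (stdSimplex ℝ (Fin n)) (k + 1) :=
  sdHomotopy bary k ∘ₗ sdIter i n k

lemma map_sdIterHomotopy (i : ℕ) {n' : ℕ} (f : Fin n → Fin n') (k : ℕ)
    (c : Chain (stdSimplex ℝ (Fin n)) k) :
    map (simplexMap f) (k + 1) (sdIterHomotopy i n k c) =
      sdIterHomotopy i n' k (map (simplexMap f) k c) := by
  rw [sdIterHomotopy, LinearMap.comp_apply, map_sdHomotopy _ _ (IsAffine.map_bary (isAffine_simplexMap f)),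
    map_sdIter]
  rfl

lemma bd_sdIterHomotopy (i : ℕ) {k : ℕ} (c : Chain (stdSimplex ℝ (Fin n)) (k + 1)) :
    bd (k + 1) (sdIterHomotopy i n (k + 1) c) =
      sdIter i n (k + 1) c - sdIter (i + 1) n (k + 1) c - sdIterHomotopy i n k (bd k c) := by
  rw [sdIterHomotopy, LinearMap.comp_apply, bd_sdHomotopy, bd_sdIter, sdIter_succ]
  rfl

end OrderedChain

/-! ### The small simplices theorem. -/

namespace SingularChain

open OrderedChain ConvexComb

variable {X : Type*} [TopologicalSpace X]

/-- Simplices contained in one of two sets. -/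
def Small (W₁ W₂ : Set X) {k : ℕ} (σ : C(stdSimplex ℝ (Fin k), X)) : Prop :=
  Set.range σ ⊆ W₁ ∨ Set.range σ ⊆ W₂

/-- The mesh tends to zero, so it falls below the Lebesgue number of the cover pulled back along
`σ`. The statement is about all large `i` because a simplex and its faces must be compared at common
stages. -/
lemma eventually_small {W₁ W₂ : Set X} (h₁ : IsOpen W₁) (h₂ : IsOpen W₂) {k : ℕ}
    {σ : C(stdSimplex ℝ (Fin k), X)} (hσ : Set.range σ ⊆ W₁ ∪ W₂) :
    ∀ᶠ i in Filter.atTop,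
      real σ k (sdIter i k k (OrderedChain.of (taut k))) ∈ supp (Small W₁ W₂) ∧
      real σ (k + 1) (sdIterHomotopy i k k (OrderedChain.of (taut k))) ∈ supp (Small W₁ W₂) := by
  obtain ⟨δ, hδ, hL⟩ := lebesgue_number_lemma_of_metric (s := Set.univ)
    (c := fun b : Bool => σ ⁻¹' (bif b then W₁ else W₂)) isCompact_univ
    (fun b => by cases b <;> exact IsOpen.preimage σ.continuous ‹_›)
    (fun t _ => by
      rcases hσ ⟨t, rfl⟩ with h | h
      · exact Set.mem_iUnion.2 ⟨true, h⟩
      · exact Set.mem_iUnion.2 ⟨false, h⟩)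
  have key : ∀ {l : ℕ} (w : Fin l → stdSimplex ℝ (Fin k)), Fine (δ / 2) w →
      of (σ.comp (comb w)) ∈ supp (Small W₁ W₂) := fun {l} w hw => by
    refine of_mem_supp ?_
    by_cases hl : IsEmpty (stdSimplex ℝ (Fin l))
    · left; rintro _ ⟨t, rfl⟩; exact (hl.false t).elim
    · obtain ⟨t₀⟩ := not_isEmpty_iff.1 hl
      obtain ⟨b, hb⟩ := hL (comb w t₀) trivial
      have : ∀ t, σ (comb w t) ∈ (bif b then W₁ else W₂) := fun t => hb <| by
        have := hw.dist_le_of_mem_hull (comb_mem_hull w t) (comb_mem_hull w t₀)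
        rw [Metric.mem_ball]; linarith
      cases b
      · right; rintro _ ⟨t, rfl⟩; exact this t
      · left; rintro _ ⟨t, rfl⟩; exact this t
  -- The standard simplex lies in the unit ball about `0`, hence the bound `2`.
  have h1 : OrderedChain.of (taut k) ∈
      OrderedChain.supp fun w : Fin k → stdSimplex ℝ (Fin k) => Fine 2 w := by
    refine OrderedChain.of_mem_supp fun i j => ?_
    have hb := stdSimplex_subset_closedBall (ι := Fin k)
    have h1 := hb (taut k i).2
    have h2 := hb (taut k j).2
    rw [Metric.mem_closedBall] at h1 h2
    exact (dist_triangle_right (taut k i).1 (taut k j).1 0).trans (by linarith)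
  have hq : Filter.Tendsto (fun i : ℕ => (((k : ℝ) - 1) / k) ^ i * 2) Filter.atTop (nhds (0 * 2)) := by
    refine Filter.Tendsto.mul_const _ ?_
    rcases Nat.eq_zero_or_pos k with rfl | hk
    · simp
    · have hk' : (1 : ℝ) ≤ k := by exact_mod_cast hk
      refine tendsto_pow_atTop_nhds_zero_of_lt_one (div_nonneg (by linarith) (by linarith)) ?_
      rw [div_lt_one (by linarith)]
      linarith
  rw [zero_mul] at hq
  filter_upwards [hq.eventually_lt_const (half_pos hδ)] with i hi
  have h2 := OrderedChain.supp_mono (fun w (hw : Fine _ w) i j => (hw i j).trans hi.le)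
    (sdIter_mem i h1)
  refine ⟨OrderedChain.map_mem_of_supp (fun w hw => ?_) h2, ?_⟩
  · rw [real_of]; exact key w hw
  · have h3 : sdIterHomotopy i k k (OrderedChain.of (taut k)) ∈
        OrderedChain.supp fun w : Fin (k + 1) → stdSimplex ℝ (Fin k) => Fine (δ / 2) w :=
      OrderedChain.map_mem_of_supp (fun w hw => sdHomotopy_of_mem w hw) h2
    refine OrderedChain.map_mem_of_supp (fun w hw => ?_) h3
    rw [real_of]; exact key w hw

/-- The subdivisions of a simplex after `i` steps, and their homotopies, are small. -/
def GoodAt (W₁ W₂ : Set X) (i : ℕ) {k : ℕ} (σ : C(stdSimplex ℝ (Fin k), X)) : Prop :=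
  real σ k (sdIter i k k (OrderedChain.of (taut k))) ∈ supp (Small W₁ W₂) ∧
    real σ (k + 1) (sdIterHomotopy i k k (OrderedChain.of (taut k))) ∈ supp (Small W₁ W₂)

/-- The faces of `σ` are included by allowing every map of vertices. The hypothesis on the range
stands inside the existential so that `N` can be chosen as a function of all simplices. -/
lemma exists_subdivisions {W₁ W₂ : Set X} (h₁ : IsOpen W₁) (h₂ : IsOpen W₂) (k : ℕ)
    (σ : C(stdSimplex ℝ (Fin k), X)) : ∃ N : ℕ, Set.range σ ⊆ W₁ ∪ W₂ → ∀ i ≥ N,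
      GoodAt W₁ W₂ i σ ∧ ∀ f : Fin (k - 1) → Fin k, GoodAt W₁ W₂ i (σ.comp (simplexMap f)) := by
  by_cases h : Set.range σ ⊆ W₁ ∪ W₂
  · have hf : ∀ f : Fin (k - 1) → Fin k, Set.range (σ.comp (simplexMap f)) ⊆ W₁ ∪ W₂ := by
      rintro f _ ⟨t, rfl⟩
      exact h ⟨_, rfl⟩
    obtain ⟨N, hN⟩ := Filter.eventually_atTop.1 ((eventually_small h₁ h₂ h).and
      (Filter.eventually_all.2 fun f => eventually_small h₁ h₂ (hf f)))
    exact ⟨N, fun _ => hN⟩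
  · exact ⟨0, fun h' => (h h').elim⟩

lemma sum_range_sub_sum_range_mem {A : Type*} [AddCommGroup A] {S : Submodule ℤ A} {f : ℕ → A}
    {M N : ℕ} (h : ∀ i, min M N ≤ i → f i ∈ S) :
    ∑ i ∈ Finset.range M, f i - ∑ i ∈ Finset.range N, f i ∈ S := by
  rcases le_total M N with hMN | hMN
  · rw [← neg_sub, ← Finset.sum_Ico_eq_sub _ hMN]
    exact neg_mem (Submodule.sum_mem _ fun i hi => h i ((min_le_left _ _).trans
      (Finset.mem_Ico.1 hi).1))
  · rw [← Finset.sum_Ico_eq_sub _ hMN]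
    exact Submodule.sum_mem _ fun i hi => h i ((min_le_right _ _).trans (Finset.mem_Ico.1 hi).1)

/-- The small simplices theorem: the simplices contained in the union of two open sets can be
deformed into chains of small simplices. -/
theorem exists_small_deformation {W₁ W₂ : Set X} (h₁ : IsOpen W₁) (h₂ : IsOpen W₂) :
    ∃ D : ∀ k, Chain X k →ₗ[ℤ] Chain X (k + 1),
      (∀ k (σ : C(stdSimplex ℝ (Fin k), X)),
        D k (of σ) ∈ supp fun τ => Set.range τ ⊆ Set.range σ) ∧
      ∀ k (σ : C(stdSimplex ℝ (Fin (k + 1)), X)), Set.range σ ⊆ W₁ ∪ W₂ →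
        of σ - bd (k + 1) (D (k + 1) (of σ)) - D k (bd k (of σ)) ∈ supp (Small W₁ W₂) := by
  -- The number of subdivisions depends on the simplex, so `D` is not a uniform iterate: it sums the
  -- homotopies over `i < N k σ`.
  choose N hN using exists_subdivisions h₁ h₂
  let T : ∀ k, ℕ → C(stdSimplex ℝ (Fin k), X) → Chain X (k + 1) := fun k i σ =>
    real σ (k + 1) (sdIterHomotopy i k k (OrderedChain.of (taut k)))
  refine ⟨fun k => lift fun σ => ∑ i ∈ Finset.range (N k σ), T k i σ, fun k σ => ?_,
    fun k σ hσ => ?_⟩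
  · rw [lift_of]
    exact Submodule.sum_mem _ fun i _ => real_mem_range _ _
  · have hface : ∀ j, Set.range (face σ j) ⊆ W₁ ∪ W₂ := fun j => (range_face_subset σ j).trans hσ
    -- For a common number `M` of stages on `σ` and its faces the homotopy identities telescope.
    have hbd : ∀ M : ℕ, bd (k + 1) (∑ i ∈ Finset.range M, T (k + 1) i σ) =
        of σ - real σ (k + 1) (sdIter M (k + 1) (k + 1) (OrderedChain.of (taut (k + 1)))) -
        ∑ j : Fin (k + 1), (-1 : ℤ) ^ (j : ℕ) • ∑ i ∈ Finset.range M, T k i (face σ j) := by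
      intro M
      induction M with
      | zero => simp [sdIter_zero, real_taut]
      | succ M ih =>
        have hT : bd (k + 1) (T (k + 1) M σ) =
            real σ (k + 1) (sdIter M (k + 1) (k + 1) (OrderedChain.of (taut (k + 1)))) -
            real σ (k + 1) (sdIter (M + 1) (k + 1) (k + 1) (OrderedChain.of (taut (k + 1)))) -
            ∑ j : Fin (k + 1), (-1 : ℤ) ^ (j : ℕ) • T k M (face σ j) := by
          rw [bd_real, bd_sdIterHomotopy, map_sub, map_sub,
            sum_real_face (j := fun k => k + 1) (fun n k => sdIterHomotopy M n k)
              (fun f k c => map_sdIterHomotopy M f k c)]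
        rw [Finset.sum_range_succ, map_add, ih, hT]
        simp only [Finset.sum_range_succ, smul_add, Finset.sum_add_distrib]
        abel
    -- The price for using different numbers on `σ` and on its faces: the extra terms have index at
    -- least one of the two numbers, so each is already small.
    have hdiff : ∑ j : Fin (k + 1), (-1 : ℤ) ^ (j : ℕ) •
        (∑ i ∈ Finset.range (N (k + 1) σ), T k i (face σ j) -
          ∑ i ∈ Finset.range (N k (face σ j)), T k i (face σ j)) ∈ supp (Small W₁ W₂) := by
      refine Submodule.sum_mem _ fun j _ => Submodule.smul_mem _ _
        (sum_range_sub_sum_range_mem fun i hi => ?_)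
      rcases min_le_iff.1 hi with hi | hi
      · exact ((hN (k + 1) σ hσ i hi).2 j.succAbove).2
      · exact ((hN k (face σ j) (hface j) i hi).1).2
    convert add_mem (hN (k + 1) σ hσ _ le_rfl).1.1 hdiff using 1
    rw [lift_of, hbd, bd_of, map_sum]
    simp only [map_smul, lift_of, smul_sub, Finset.sum_sub_distrib]
    abel

end SingularChain

/-! ### The prism operator and chain homotopies. -/

namespace SingularChain

open OrderedChain ConvexComb

variable {X Y Z : Type*} [TopologicalSpace X] [TopologicalSpace Y] [TopologicalSpace Z]

lemma comb_const {n k : ℕ} (x : stdSimplex ℝ (Fin n)) :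
    comb (fun _ : Fin k => x) = ContinuousMap.const _ x := by
  ext t j
  change (comb (fun _ : Fin k => x) t : Fin n → ℝ) j = _
  rw [coe_comb, ← Finset.sum_smul, stdSimplex.sum_eq_one, one_smul]
  rfl

/-- The inclusion of an end of the prism over a simplex. -/
noncomputable def prismEnd (n : ℕ) (e : Fin 2) :
    C(stdSimplex ℝ (Fin n), stdSimplex ℝ (Fin n) × stdSimplex ℝ (Fin 2)) :=
  (ContinuousMap.id _).prodMk (ContinuousMap.const _ (stdSimplex.vertex e))

/-- The difference of the two ends of the prism, on ordered chains. -/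
noncomputable def prismEnds (n k : ℕ) : OrderedChain.Chain (stdSimplex ℝ (Fin n)) k →ₗ[ℤ]
    OrderedChain.Chain (stdSimplex ℝ (Fin n) × stdSimplex ℝ (Fin 2)) k :=
  OrderedChain.map (prismEnd n 1) k - OrderedChain.map (prismEnd n 0) k

/-- The prism operator on ordered chains. -/
noncomputable def prism (n k : ℕ) : OrderedChain.Chain (stdSimplex ℝ (Fin n)) k →ₗ[ℤ]
    OrderedChain.Chain (stdSimplex ℝ (Fin n) × stdSimplex ℝ (Fin 2)) (k + 1) :=
  fill (prismEnds n) (fun _ v => prismEnd n 0 (v 0)) k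

lemma bd_prism {n k : ℕ} (c : OrderedChain.Chain (stdSimplex ℝ (Fin n)) (k + 1)) :
    OrderedChain.bd (k + 1) (prism n (k + 1) c) =
      prismEnds n (k + 1) c - prism n k (OrderedChain.bd k c) := by
  refine bd_fill _ ?_ (fun k c => ?_) c
  -- The two ends of the prism agree on the empty tuple, the only one in degree `0`.
  · refine OrderedChain.hom_ext fun v => ?_
    rw [prismEnds, LinearMap.sub_apply, map_of, map_of, LinearMap.zero_apply, sub_eq_zero]
    congr 1
    exact Subsingleton.elim _ _
  · simp [prismEnds, OrderedChain.bd_map]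

lemma map_prism {n n' : ℕ} (f : Fin n → Fin n') (k : ℕ)
    (c : OrderedChain.Chain (stdSimplex ℝ (Fin n)) k) :
    OrderedChain.map ((simplexMap f).prodMap (ContinuousMap.id _)) (k + 1) (prism n k c) =
      prism n' k (OrderedChain.map (simplexMap f) k c) := by
  refine map_fill (simplexMap f) _ (fun k c => ?_) (fun k v => rfl) k c
  have : OrderedChain.map ((simplexMap f).prodMap (ContinuousMap.id _)) k ∘ₗ prismEnds n k =
      prismEnds n' k ∘ₗ OrderedChain.map (simplexMap f) k := by
    refine OrderedChain.hom_ext fun v => ?_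
    simp only [LinearMap.comp_apply, prismEnds, LinearMap.sub_apply, map_of, map_sub]
    rfl
  exact LinearMap.congr_fun this c

lemma isAffine_prodMap_id {k l : ℕ} (f : Fin k → Fin l) :
    IsAffine ((simplexMap f).prodMap (ContinuousMap.id (stdSimplex ℝ (Fin 2)))) := by
  intro n v
  have h := isAffine_simplexMap f (Prod.fst ∘ v)
  refine ContinuousMap.ext fun t => Prod.ext ?_ ?_
  · exact DFunLike.congr_fun h t
  · rfl

/-- The chain homotopy induced by a homotopy. -/
theorem exists_chain_homotopy {f g : C(X, Y)} (H : f.Homotopy g) :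
    ∃ K : ∀ k, Chain X k →ₗ[ℤ] Chain Y (k + 1),
      (∀ k (σ : C(stdSimplex ℝ (Fin k), X)), K k (of σ) ∈ supp fun τ =>
        Set.range τ ⊆ {y | ∃ t, ∃ x ∈ Set.range σ, H (t, x) = y}) ∧
      ∀ k (σ : C(stdSimplex ℝ (Fin (k + 1)), X)),
        bd (k + 1) (K (k + 1) (of σ)) = of (g.comp σ) - of (f.comp σ) - K k (bd k (of σ)) := by
  let e : C(stdSimplex ℝ (Fin 2), unitInterval) :=
    ⟨stdSimplexHomeomorphUnitInterval, stdSimplexHomeomorphUnitInterval.continuous⟩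
  let H' : C(X × stdSimplex ℝ (Fin 2), Y) :=
    H.toContinuousMap.comp ((e.comp ContinuousMap.snd).prodMk ContinuousMap.fst)
  let A : ∀ {k : ℕ} (σ : C(stdSimplex ℝ (Fin k), X)),
      C(stdSimplex ℝ (Fin k) × stdSimplex ℝ (Fin 2), Y) := fun σ =>
    H'.comp (σ.prodMap (ContinuousMap.id _))
  refine ⟨fun k => lift fun σ => real (A σ) (k + 1) (prism k k (OrderedChain.of (taut k))),
    fun k σ => ?_, fun k σ => ?_⟩
  · rw [lift_of]
    refine supp_mono (fun τ hτ => ?_) (real_mem_range _ _)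
    refine hτ.trans ?_
    rintro _ ⟨⟨s, t⟩, rfl⟩
    exact ⟨e t, σ s, ⟨s, rfl⟩, rfl⟩
  · rw [lift_of, bd_real, bd_prism, map_sub]
    congr 1
    · rw [prismEnds, LinearMap.sub_apply, map_sub, map_of, map_of, real_of, real_of]
      have hc : ∀ i : Fin 2, comb (prismEnd (k + 1) i ∘ taut (k + 1)) = prismEnd (k + 1) i := by
        intro i
        refine ContinuousMap.ext fun t => Prod.ext ?_ ?_
        · exact DFunLike.congr_fun (comb_taut (k + 1)) t
        · exact DFunLike.congr_fun (comb_const (stdSimplex.vertex i)) t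
      rw [hc, hc]
      congr 2
      · ext t
        change H (e (stdSimplex.vertex 1), σ t) = g (σ t)
        have : e (stdSimplex.vertex 1) = 1 := stdSimplexHomeomorphUnitInterval_one
        rw [this, H.apply_one]
      · ext t
        change H (e (stdSimplex.vertex 0), σ t) = f (σ t)
        have : e (stdSimplex.vertex 0) = 0 := stdSimplexHomeomorphUnitInterval_zero
        rw [this, H.apply_zero]
    · rw [bd_of, OrderedChain.bd_of, map_sum, map_sum, map_sum]
      refine Finset.sum_congr rfl fun i _ => ?_
      rw [map_smul, map_smul, map_smul, lift_of, taut_comp, ← map_of, ← map_prism,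
        ← real_comp _ (isAffine_prodMap_id _)]
      rfl

lemma bd_bd {k : ℕ} (c : Chain X (k + 2)) : bd k (bd (k + 1) c) = 0 := by
  have : (bd k).comp (bd (k + 1)) = (0 : Chain X (k + 2) →ₗ[ℤ] Chain X k) := by
    refine hom_ext fun σ => ?_
    rw [← real_taut σ, LinearMap.comp_apply, bd_real, bd_real, OrderedChain.bd_bd, map_zero]
    rfl
  exact LinearMap.congr_fun this c

/-! ### Cochains and relative cochains. -/

/-- Integral singular cochains on simplices with `k` vertices. -/
abbrev Cochain (X : Type*) [TopologicalSpace X] (k : ℕ) : Type _ := C(stdSimplex ℝ (Fin k), X) → ℤ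

/-- Evaluation of a cochain on chains. -/
noncomputable abbrev eval {k : ℕ} (φ : Cochain X k) : Chain X k →ₗ[ℤ] ℤ := lift φ

lemma eval_of {k : ℕ} (φ : Cochain X k) (σ : C(stdSimplex ℝ (Fin k), X)) :
    eval φ (of σ) = φ σ := lift_of _ _

/-- The coboundary. -/
noncomputable def d (k : ℕ) : Cochain X k →ₗ[ℤ] Cochain X (k + 1) where
  toFun φ σ := ∑ i : Fin (k + 1), (-1) ^ (i : ℕ) * φ (face σ i)
  map_add' φ ψ := by
    funext s
    simp [mul_add, Finset.sum_add_distrib]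
  map_smul' c φ := by
    funext s
    simp only [Pi.smul_apply, smul_eq_mul, RingHom.id_apply, Finset.mul_sum]
    exact Finset.sum_congr rfl fun i _ => by ring

lemma d_apply {k : ℕ} (φ : Cochain X k) (σ : C(stdSimplex ℝ (Fin (k + 1)), X)) :
    d k φ σ = ∑ i : Fin (k + 1), (-1) ^ (i : ℕ) * φ (face σ i) := rfl

lemma eval_d {k : ℕ} (φ : Cochain X k) (c : Chain X (k + 1)) :
    eval (d k φ) c = eval φ (bd k c) := by
  have : eval (d k φ) = (eval φ).comp (bd k) := by
    refine hom_ext fun σ => ?_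
    rw [eval_of, LinearMap.comp_apply, bd_of, map_sum]
    simp only [map_smul, eval_of, smul_eq_mul, d_apply]
  exact LinearMap.congr_fun this c

lemma d_apply' {k : ℕ} (φ : Cochain X k) (σ : C(stdSimplex ℝ (Fin (k + 1)), X)) :
    d k φ σ = eval φ (bd k (of σ)) := by rw [← eval_d, eval_of]

lemma d_d {k : ℕ} (φ : Cochain X k) : d (k + 1) (d k φ) = 0 := by
  funext σ
  rw [d_apply', eval_d, bd_bd, map_zero]; rfl

/-- The transpose of an operator on chains. -/
noncomputable def transpose {k l : ℕ} (D : Chain X k →ₗ[ℤ] Chain Y l) (φ : Cochain Y l) :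
    Cochain X k := fun σ => eval φ (D (of σ))

lemma eval_transpose {k l : ℕ} (D : Chain X k →ₗ[ℤ] Chain Y l) (φ : Cochain Y l)
    (c : Chain X k) : eval (transpose D φ) c = eval φ (D c) := by
  have : eval (transpose D φ) = (eval φ).comp D := hom_ext fun σ => by
    rw [eval_of]; rfl
  exact LinearMap.congr_fun this c

/-- Restriction of cochains along a continuous map. -/
def pull (f : C(X, Y)) (k : ℕ) : Cochain Y k →ₗ[ℤ] Cochain X k where
  toFun φ σ := φ (f.comp σ)
  map_add' _ _ := rfl
  map_smul' _ _ := rfl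

lemma pull_apply (f : C(X, Y)) {k : ℕ} (φ : Cochain Y k) (σ : C(stdSimplex ℝ (Fin k), X)) :
    pull f k φ σ = φ (f.comp σ) := rfl

lemma d_pull (f : C(X, Y)) {k : ℕ} (φ : Cochain Y k) :
    d k (pull f k φ) = pull f (k + 1) (d k φ) := rfl

/-- The cochains vanishing on the simplices in `W`. -/
def rc (W : Set X) (k : ℕ) : Submodule ℤ (Cochain X k) where
  carrier := {φ | ∀ σ : C(stdSimplex ℝ (Fin k), X), Set.range σ ⊆ W → φ σ = 0}
  add_mem' hφ hψ σ hσ := by simp [hφ σ hσ, hψ σ hσ]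
  zero_mem' _ _ := rfl
  smul_mem' c φ hφ σ hσ := by simp [hφ σ hσ]

/-- The cocycles vanishing on the simplices in `W`. -/
noncomputable def rz (W : Set X) (k : ℕ) : Submodule ℤ (Cochain X k) :=
  rc W k ⊓ LinearMap.ker (d k)

/-- The coboundaries of cochains vanishing on the simplices in `W`. -/
noncomputable def rb (W : Set X) (k : ℕ) : Submodule ℤ (Cochain X (k + 1)) := (rc W k).map (d k)

lemma rc_anti {V W : Set X} (h : V ⊆ W) (k : ℕ) : rc W k ≤ rc V k :=
  fun _ hφ σ hσ => hφ σ (hσ.trans h)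

lemma rz_anti {V W : Set X} (h : V ⊆ W) (k : ℕ) : rz W k ≤ rz V k :=
  inf_le_inf_right _ (rc_anti h k)

lemma rb_anti {V W : Set X} (h : V ⊆ W) (k : ℕ) : rb W k ≤ rb V k :=
  Submodule.map_mono (rc_anti h k)

lemma d_mem_rc {W : Set X} {k : ℕ} {φ : Cochain X k} (h : φ ∈ rc W k) : d k φ ∈ rc W (k + 1) :=
  fun σ hσ => by
    rw [d_apply]
    exact Finset.sum_eq_zero fun i _ => by rw [h _ ((range_face_subset σ i).trans hσ), mul_zero]

lemma rb_le_rz (W : Set X) (k : ℕ) : rb W k ≤ rz W (k + 1) := by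
  rintro _ ⟨φ, hφ, rfl⟩
  exact ⟨d_mem_rc hφ, d_d φ⟩

lemma eval_eq_zero {k : ℕ} {φ : Cochain X k} {p : C(stdSimplex ℝ (Fin k), X) → Prop}
    (h : ∀ σ, p σ → φ σ = 0) {c : Chain X k} (hc : c ∈ supp p) : eval φ c = 0 :=
  (Submodule.mem_bot ℤ).1 (map_mem_of_supp (fun σ hσ => by
    rw [eval_of, h σ hσ]; exact zero_mem _) hc)

lemma rz_univ (k : ℕ) : rz (Set.univ : Set X) k = ⊥ :=
  eq_bot_iff.2 fun _ hφ => (Submodule.mem_bot ℤ).2 (funext fun σ => hφ.1 σ (Set.subset_univ _))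

/-- Cochain form of the small simplices theorem. -/
theorem exists_sub_d_mem_rc {W₁ W₂ : Set X} (h₁ : IsOpen W₁) (h₂ : IsOpen W₂) {k : ℕ}
    {φ : Cochain X (k + 1)} (hφ₁ : φ ∈ rc W₁ (k + 1)) (hφ₂ : φ ∈ rc W₂ (k + 1))
    (hd : d (k + 1) φ ∈ rc (W₁ ∪ W₂) (k + 2)) :
    ∃ θ ∈ rc W₁ k ⊓ rc W₂ k, φ - d k θ ∈ rc (W₁ ∪ W₂) (k + 1) := by
  obtain ⟨D, hD, hs⟩ := exists_small_deformation h₁ h₂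
  refine ⟨transpose (D k) φ, ⟨fun σ hσ => eval_eq_zero hφ₁ (supp_mono (fun τ h => h.trans hσ)
    (hD k σ)), fun σ hσ => eval_eq_zero hφ₂ (supp_mono (fun τ h => h.trans hσ) (hD k σ))⟩,
    fun σ hσ => ?_⟩
  -- `φ` kills the small chain. Since `φ(∂Dσ) = (dφ)(Dσ)` and `Dσ` stays in the range of `σ`, this
  -- term vanishes too, which leaves `φ(σ) = φ(D∂σ) = (dθ)(σ)`.
  have h := eval_eq_zero (φ := φ) (fun τ hτ => hτ.elim (hφ₁ τ) (hφ₂ τ)) (hs k σ hσ)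
  rw [map_sub, map_sub, ← eval_d, eval_of, eval_eq_zero hd
    (supp_mono (fun τ h => h.trans hσ) (hD _ σ)), ← eval_transpose, ← d_apply', sub_zero] at h
  exact h

/-- Homotopy invariance of relative cohomology. -/
theorem exists_pull_sub_pull_eq {f g : C(X, Y)} (H : f.Homotopy g) {V : Set X} {W : Set Y}
    (hVW : ∀ t, ∀ x ∈ V, H (t, x) ∈ W) {k : ℕ} {φ : Cochain Y (k + 1)} (hφ : φ ∈ rz W (k + 1)) :
    pull g (k + 1) φ - pull f (k + 1) φ ∈ rb V k := by
  obtain ⟨K, hK, hb⟩ := exists_chain_homotopy H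
  refine ⟨transpose (K k) φ, fun σ hσ => eval_eq_zero hφ.1 (supp_mono (fun τ h => ?_) (hK k σ)),
    funext fun σ => ?_⟩
  · refine h.trans ?_
    rintro _ ⟨t, x, hx, rfl⟩
    exact hVW t x (hσ hx)
  · have h := congrArg (eval φ) (hb k σ)
    rw [← eval_d, LinearMap.mem_ker.1 hφ.2, map_sub, map_sub, eval_of, eval_of] at h
    have h0 : ∀ c, eval (0 : Cochain Y (k + 2)) c = 0 := fun c => by simp [eval]
    rw [h0, ← eval_transpose, ← d_apply'] at h
    rw [Pi.sub_apply, pull_apply, pull_apply]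
    linarith

end SingularChain

/-! ### Mayer–Vietoris for relative cohomology. -/

namespace SingularChain

open OrderedChain ConvexComb

variable {X Y Z : Type*} [TopologicalSpace X] [TopologicalSpace Y] [TopologicalSpace Z]

/-- Vanishing is tested simplex by simplex, so it suffices to cut `φ` off on the simplices in `W₁`;
no openness is needed. -/
lemma exists_eq_sub_of_mem_rc_inter {W₁ W₂ : Set X} {k : ℕ} {φ : Cochain X k}
    (hφ : φ ∈ rc (W₁ ∩ W₂) k) : ∃ φ₁ ∈ rc W₁ k, ∃ φ₂ ∈ rc W₂ k, φ = φ₁ - φ₂ := by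
  classical
  let φ₁ : Cochain X k := fun σ => if Set.range σ ⊆ W₁ then 0 else φ σ
  refine ⟨φ₁, fun σ hσ => if_pos hσ, φ₁ - φ, fun σ hσ => ?_, by abel⟩
  by_cases h : Set.range σ ⊆ W₁
  · rw [Pi.sub_apply, hφ σ (Set.subset_inter h hσ)]
    simp [φ₁, h]
  · simp [φ₁, h]

section MayerVietoris

variable {W₁ W₂ : Set X} (h₁ : IsOpen W₁) (h₂ : IsOpen W₂)

include h₁ h₂

/-- If the relative cohomology of the union vanishes in the next degree, then a cocycle relative
to the intersection is a sum of cocycles relative to the two open sets. -/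
theorem rz_inter_le {k : ℕ} (h : rz (W₁ ∪ W₂) (k + 1) ≤ rb (W₁ ∪ W₂) k) :
    rz (W₁ ∩ W₂) k ≤ rz W₁ k ⊔ rz W₂ k := by
  rintro φ ⟨hφ, hd⟩
  obtain ⟨φ₁, hφ₁, φ₂, hφ₂, rfl⟩ := exists_eq_sub_of_mem_rc_inter hφ
  have e : d k φ₁ = d k φ₂ := by
    rw [SetLike.mem_coe, LinearMap.mem_ker, map_sub, sub_eq_zero] at hd
    exact hd
  -- The common coboundary represents the connecting class. `θ` makes it vanish on the simplices of
  -- the union; the hypothesis then supplies a primitive `γ` to subtract from both parts.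
  obtain ⟨θ, ⟨hθ₁, hθ₂⟩, hθ⟩ := exists_sub_d_mem_rc h₁ h₂ (φ := d k φ₁) (d_mem_rc hφ₁)
    (e ▸ d_mem_rc hφ₂) (by rw [d_d]; exact zero_mem _)
  obtain ⟨γ, hγ, hγ'⟩ := h ⟨hθ, by
    rw [SetLike.mem_coe, LinearMap.mem_ker, map_sub, d_d, d_d, sub_zero]⟩
  have hγ₁ := rc_anti Set.subset_union_left _ hγ
  have hγ₂ := rc_anti Set.subset_union_right _ hγ
  have : φ₁ - φ₂ = (φ₁ - θ - γ) + -(φ₂ - θ - γ) := by abel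
  rw [this]
  refine add_mem (Submodule.mem_sup_left ⟨sub_mem (sub_mem hφ₁ hθ₁) hγ₁, ?_⟩)
    (Submodule.mem_sup_right (neg_mem ⟨sub_mem (sub_mem hφ₂ hθ₂) hγ₂, ?_⟩))
  · rw [SetLike.mem_coe, LinearMap.mem_ker, map_sub, map_sub, hγ', sub_self]
  · rw [SetLike.mem_coe, LinearMap.mem_ker, map_sub, map_sub, hγ', ← e, sub_self]

/-- If the primitives on the two pieces differ by a relative coboundary, splitting its primitive
adjusts them to one common cochain. A small-simplices correction then makes it vanish on the whole
union. -/
lemma mem_rb_union {k : ℕ} {φ : Cochain X (k + 2)} {ψ₁ ψ₂ : Cochain X (k + 1)}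
    (hφ : φ ∈ rc (W₁ ∪ W₂) (k + 2)) (hψ₁ : ψ₁ ∈ rc W₁ (k + 1)) (hψ₂ : ψ₂ ∈ rc W₂ (k + 1))
    (e₁ : d (k + 1) ψ₁ = φ) (hψ : ψ₁ - ψ₂ ∈ rb (W₁ ∩ W₂) k) :
    φ ∈ rb (W₁ ∪ W₂) (k + 1) := by
  obtain ⟨χ, hχ, hχ'⟩ := hψ
  obtain ⟨χ₁, hχ₁, χ₂, hχ₂, rfl⟩ := exists_eq_sub_of_mem_rc_inter hχ
  have e : ψ₁ - d k χ₁ = ψ₂ - d k χ₂ := by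
    rw [map_sub, sub_eq_sub_iff_add_eq_add] at hχ'
    rw [sub_eq_sub_iff_add_eq_add, ← hχ']
    exact add_comm _ _
  have e' : d (k + 1) (ψ₁ - d k χ₁) = φ := by rw [map_sub, d_d, sub_zero, e₁]
  obtain ⟨θ, -, hθ⟩ := exists_sub_d_mem_rc h₁ h₂ (sub_mem hψ₁ (d_mem_rc hχ₁))
    (e ▸ sub_mem hψ₂ (d_mem_rc hχ₂)) (by rw [e']; exact hφ)
  exact ⟨_, hθ, by rw [map_sub, e', d_d, sub_zero]⟩

/-- Primitives on the two pieces differ by a cocycle relative to the intersection, one degree lower,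
which is a coboundary by hypothesis. -/
theorem rz_union_le {k : ℕ} (hW₁ : rz W₁ (k + 2) ≤ rb W₁ (k + 1))
    (hW₂ : rz W₂ (k + 2) ≤ rb W₂ (k + 1)) (h : rz (W₁ ∩ W₂) (k + 1) ≤ rb (W₁ ∩ W₂) k) :
    rz (W₁ ∪ W₂) (k + 2) ≤ rb (W₁ ∪ W₂) (k + 1) := by
  intro φ hφ
  obtain ⟨ψ₁, hψ₁, e₁⟩ := hW₁ (rz_anti Set.subset_union_left _ hφ)
  obtain ⟨ψ₂, hψ₂, e₂⟩ := hW₂ (rz_anti Set.subset_union_right _ hφ)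
  refine mem_rb_union h₁ h₂ hφ.1 hψ₁ hψ₂ e₁ (h ⟨sub_mem (rc_anti Set.inter_subset_left _ hψ₁)
    (rc_anti Set.inter_subset_right _ hψ₂), ?_⟩)
  rw [SetLike.mem_coe, LinearMap.mem_ker, map_sub, e₁, e₂, sub_self]

end MayerVietoris

/-- The chains contained in `W`. -/
noncomputable abbrev chainsIn (W : Set X) (k : ℕ) : Submodule ℤ (Chain X k) :=
  supp fun σ => Set.range σ ⊆ W

lemma chainsIn_mono {V W : Set X} (h : V ⊆ W) (k : ℕ) : chainsIn V k ≤ chainsIn W k :=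
  supp_mono fun _ hσ => hσ.trans h

/-- Relative cohomology classes are detected by their values on relative cycles. -/
def Detected (W : Set X) (k : ℕ) : Prop :=
  ∀ φ ∈ rz W (k + 1), (∀ c, bd k c ∈ chainsIn W k → eval φ c = 0) → φ ∈ rb W k

/-- Every relative cycle bounds. -/
def Bounding (W : Set X) (k : ℕ) : Prop :=
  ∀ c : Chain X (k + 1), bd k c ∈ chainsIn W k →
    ∃ w : Chain X (k + 2), c - bd (k + 1) w ∈ chainsIn W (k + 1)

/-- Let `ψ₁`, `ψ₂` be primitives of `φ` on the two pieces. A cycle `z` relative to the intersection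
bounds `w₁` and `w₂` relative to them; `w₁ - w₂` is then a cycle relative to the union, and `φ(w₁ -
w₂) = (ψ₁ - ψ₂)(z)`. So detection of `ψ₁ - ψ₂` transfers to `φ`. -/
theorem Detected.union {W₁ W₂ : Set X} (h₁ : IsOpen W₁) (h₂ : IsOpen W₂) {k : ℕ}
    (hW₁ : rz W₁ (k + 2) ≤ rb W₁ (k + 1)) (hW₂ : rz W₂ (k + 2) ≤ rb W₂ (k + 1))
    (hb₁ : Bounding W₁ k) (hb₂ : Bounding W₂ k) (h : Detected (W₁ ∩ W₂) k) :
    Detected (W₁ ∪ W₂) (k + 1) := by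
  intro φ hφ hc
  obtain ⟨ψ₁, hψ₁, e₁⟩ := hW₁ (rz_anti Set.subset_union_left _ hφ)
  obtain ⟨ψ₂, hψ₂, e₂⟩ := hW₂ (rz_anti Set.subset_union_right _ hφ)
  refine mem_rb_union h₁ h₂ hφ.1 hψ₁ hψ₂ e₁ (h _
    ⟨sub_mem (rc_anti Set.inter_subset_left _ hψ₁) (rc_anti Set.inter_subset_right _ hψ₂), ?_⟩
    fun z hz => ?_)
  · rw [SetLike.mem_coe, LinearMap.mem_ker, map_sub, e₁, e₂, sub_self]
  · obtain ⟨w₁, hw₁⟩ := hb₁ z (chainsIn_mono Set.inter_subset_left _ hz)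
    obtain ⟨w₂, hw₂⟩ := hb₂ z (chainsIn_mono Set.inter_subset_right _ hz)
    have := hc (w₁ - w₂) (by
      have h := sub_mem (chainsIn_mono (W := W₁ ∪ W₂) Set.subset_union_right _ hw₂)
        (chainsIn_mono Set.subset_union_left _ hw₁)
      rwa [sub_sub_sub_cancel_left, ← map_sub] at h)
    have h1 := eval_eq_zero hψ₁ hw₁
    have h2 := eval_eq_zero hψ₂ hw₂
    rw [map_sub, ← eval_d, e₁] at h1
    rw [map_sub, ← eval_d, e₂] at h2
    rw [map_sub] at this
    have h3 : eval (ψ₁ - ψ₂) z = eval ψ₁ z - eval ψ₂ z := by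
      simp [eval, Finsupp.linearCombination_apply, mul_sub]
    rw [h3]; linarith

/-! ### Induced maps and contractions. -/

/-- The chain map induced by a continuous map. -/
noncomputable def push (f : C(X, Y)) (k : ℕ) : Chain X k →ₗ[ℤ] Chain Y k :=
  lift fun σ => of (f.comp σ)

lemma push_of (f : C(X, Y)) {k : ℕ} (σ : C(stdSimplex ℝ (Fin k), X)) :
    push f k (of σ) = of (f.comp σ) := lift_of _ _

lemma bd_push (f : C(X, Y)) {k : ℕ} (c : Chain X (k + 1)) :
    bd k (push f (k + 1) c) = push f k (bd k c) := by
  have : (bd k).comp (push f (k + 1)) = (push f k).comp (bd k) := by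
    refine hom_ext fun σ => ?_
    rw [LinearMap.comp_apply, LinearMap.comp_apply, push_of, bd_of, bd_of, map_sum]
    refine Finset.sum_congr rfl fun i _ => ?_
    rw [map_smul, push_of]
    rfl
  exact LinearMap.congr_fun this c

lemma eval_push (f : C(X, Y)) {k : ℕ} (φ : Cochain Y k) (c : Chain X k) :
    eval φ (push f k c) = eval (pull f k φ) c := (eval_transpose (push f k) φ c).symm.trans <| by
  congr 2
  funext σ
  rw [transpose, push_of, eval_of, pull_apply]

lemma push_mem_chainsIn (f : C(X, Y)) {V : Set X} {W : Set Y} (h : Set.MapsTo f V W) {k : ℕ}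
    {c : Chain X k} (hc : c ∈ chainsIn V k) : push f k c ∈ chainsIn W k := by
  refine map_mem_of_supp (fun σ hσ => ?_) hc
  rw [push_of]
  refine of_mem_supp ?_
  rintro _ ⟨t, rfl⟩
  exact h (hσ ⟨t, rfl⟩)

lemma pull_mem_rz (f : C(X, Y)) {V : Set X} {W : Set Y} (h : Set.MapsTo f V W) {k : ℕ}
    {φ : Cochain Y k} (hφ : φ ∈ rz W k) : pull f k φ ∈ rz V k := by
  refine ⟨fun σ hσ => hφ.1 _ ?_, ?_⟩
  · rintro _ ⟨t, rfl⟩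
    exact h (hσ ⟨t, rfl⟩)
  · rw [SetLike.mem_coe, LinearMap.mem_ker, d_pull, LinearMap.mem_ker.1 hφ.2, map_zero]

section Contraction

variable {W : Set X} {p : X} (H : (ContinuousMap.id X).Homotopy (ContinuousMap.const X p))

/-- The contraction is a homotopy of pairs from the identity to a constant map into `W`, and the
latter pulls `φ` back to zero. -/
lemma rz_le_rb_of_contraction (hp : p ∈ W) (hH : ∀ t, ∀ x ∈ W, H (t, x) ∈ W) (k : ℕ) :
    rz W (k + 1) ≤ rb W k := by
  intro φ hφ
  have h := exists_pull_sub_pull_eq H hH hφ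
  have h0 : pull (ContinuousMap.const X p) (k + 1) φ = 0 := by
    funext σ
    refine hφ.1 _ ?_
    rintro _ ⟨t, rfl⟩
    exact hp
  rw [h0, zero_sub] at h
  exact neg_mem_iff.1 h

lemma bounding_of_contraction (hp : p ∈ W) (hH : ∀ t, ∀ x ∈ W, H (t, x) ∈ W) (k : ℕ) :
    Bounding W k := by
  obtain ⟨K, hK, hb⟩ := exists_chain_homotopy H
  intro c hc
  refine ⟨-K (k + 1) c, ?_⟩
  have e : (bd (k + 1)).comp (K (k + 1)) =
      push (ContinuousMap.const X p) (k + 1) - LinearMap.id - (K k).comp (bd k) := by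
    refine hom_ext fun σ => ?_
    rw [LinearMap.comp_apply, hb]
    simp only [LinearMap.sub_apply, push_of, LinearMap.comp_apply, LinearMap.id_apply]
    rfl
  have e' : bd (k + 1) (K (k + 1) c) =
      push (ContinuousMap.const X p) (k + 1) c - c - K k (bd k c) := LinearMap.congr_fun e c
  rw [map_neg, sub_neg_eq_add, e']
  have : c + (push (ContinuousMap.const X p) (k + 1) c - c - K k (bd k c)) =
      push (ContinuousMap.const X p) (k + 1) c - K k (bd k c) := by abel
  rw [this]
  refine sub_mem (push_mem_chainsIn (V := Set.univ) _ (fun _ _ => hp) ?_)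
    (map_mem_of_supp (fun σ hσ => ?_) hc)
  · exact (Finsupp.mem_supported _ _).2 fun _ _ => Set.subset_univ _
  · refine supp_mono (fun τ hτ => hτ.trans ?_) (hK k σ)
    rintro _ ⟨t, x, hx, rfl⟩
    exact hH t x (hσ hx)

include H in
/-- The cohomology of a contractible space vanishes in positive degrees. -/
lemma rz_empty_le_rb_of_contraction (k : ℕ) :
    rz (∅ : Set X) (k + 2) ≤ rb ∅ (k + 1) := by
  intro φ hφ
  have h := exists_pull_sub_pull_eq H (V := ∅) (W := ∅) (fun _ _ h => h.elim) hφ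
  have hrc : ∀ {l : ℕ} (ψ : Cochain X (l + 1)), ψ ∈ rc (∅ : Set X) (l + 1) := fun ψ σ hσ =>
    (hσ ⟨stdSimplex.barycenter, rfl⟩).elim
  set a : ℤ := φ (ContinuousMap.const _ p) with ha
  have hc : pull (ContinuousMap.const X p) (k + 2) φ = fun _ => a := rfl
  have hconst : (fun _ => a : Cochain X (k + 2)) ∈ rb (∅ : Set X) (k + 1) := by
    have hd : ∀ (l : ℕ) (σ : C(stdSimplex ℝ (Fin (l + 1)), X)),
        d l (fun _ => a) σ = if Even (l + 1) then 0 else a := fun l σ => by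
      rw [d_apply, ← Finset.sum_mul, Fin.sum_neg_one_pow]
      split_ifs <;> simp
    -- The coboundary of a constant cochain is an alternating sum of equal terms. With an even
    -- number of faces the cocycle condition one degree up forces `a = 0`; with an odd number the
    -- constant is its own coboundary.
    by_cases hk : Even (k + 2)
    · refine ⟨fun _ => 0, hrc _, ?_⟩
      have h0 := congrFun (LinearMap.mem_ker.1 hφ.2) (ContinuousMap.const _ p)
      have h1 : d (k + 2) φ (ContinuousMap.const _ p) = d (k + 2) (fun _ => a)
        (ContinuousMap.const _ p) := rfl
      rw [h1, hd, if_neg (by rw [Nat.even_add_one]; exact not_not.2 hk)] at h0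
      have h0' : a = 0 := h0
      rw [h0']
      exact map_zero (d (k + 1))
    · exact ⟨fun _ => a, hrc _, funext fun σ => by rw [hd, if_neg hk]⟩
  rw [hc] at h
  have := sub_mem hconst h
  rwa [sub_sub_cancel] at this

end Contraction

/-! ### Excision along open embeddings. -/

section Excision

variable {e : C(Y, X)}

/-- Extension of a cochain by zero. -/
noncomputable def extend (e : C(Y, X)) {k : ℕ} (ψ : Cochain Y k) : Cochain X k := by
  classical
  exact fun τ => if h : ∃ σ, e.comp σ = τ then ψ h.choose else 0

lemma pull_extend (he : Function.Injective e) {k : ℕ} (ψ : Cochain Y k) :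
    pull e k (extend e ψ) = ψ := by
  funext σ
  have h : ∃ σ', e.comp σ' = e.comp σ := ⟨σ, rfl⟩
  rw [pull_apply, extend, dif_pos h]
  congr 1
  exact (ContinuousMap.cancel_left he).1 h.choose_spec

lemma extend_mem_rc {k : ℕ} {W : Set X} {ψ : Cochain Y k} (hψ : ψ ∈ rc (e ⁻¹' W) k) :
    extend e ψ ∈ rc W k := by
  intro τ hτ
  rw [extend]
  split_ifs with h
  · refine hψ _ ?_
    rintro _ ⟨t, rfl⟩
    refine hτ ⟨t, ?_⟩
    exact (DFunLike.congr_fun h.choose_spec t).symm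
  · rfl

lemma exists_lift_simplex (he : Topology.IsEmbedding e) {k : ℕ} {τ : C(stdSimplex ℝ (Fin k), X)}
    (h : Set.range τ ⊆ Set.range e) : ∃ σ, e.comp σ = τ := by
  choose f hf using fun t => h ⟨t, rfl⟩
  refine ⟨⟨f, he.continuous_iff.2 ?_⟩, ContinuousMap.ext hf⟩
  have : e ∘ f = τ := funext hf
  rw [this]
  exact τ.continuous

/-- Excision along an open embedding. -/
theorem mem_rz_sup_rb_of_pull (he : Topology.IsOpenEmbedding e) {W W' : Set X} (hW : IsOpen W)
    (hW' : IsOpen W') (hWW' : W ⊆ W') (hcover : W' ⊆ W ∪ Set.range e) {k : ℕ}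
    {φ : Cochain X (k + 1)} (hφ : φ ∈ rz W (k + 1))
    (h : pull e (k + 1) φ ∈ rz (e ⁻¹' W') (k + 1) ⊔ rb (e ⁻¹' W) k) :
    φ ∈ rz W' (k + 1) ⊔ rb W k := by
  obtain ⟨α, hα, _, ⟨ψ, hψ, rfl⟩, hsum⟩ := Submodule.mem_sup.1 h
  have hx := extend_mem_rc hψ
  have hV : W ∪ Set.range e ∩ W' = W' := by
    ext x
    constructor
    · rintro (h | h)
      exacts [hWW' h, h.2]
    · intro h
      rcases hcover h with h' | h'
      exacts [Or.inl h', Or.inr ⟨h', h⟩]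
  have hd : d (k + 1) (φ - d k (extend e ψ)) = 0 := by
    rw [map_sub, d_d, LinearMap.mem_ker.1 hφ.2, sub_zero]
  -- Once the extended coboundary is subtracted, the cocycle vanishes on simplices in `W` and, being
  -- `α` there, on those in `range e ∩ W'`. These two open sets cover `W'`.
  obtain ⟨θ, ⟨hθ, -⟩, hθ'⟩ := exists_sub_d_mem_rc hW (he.isOpen_range.inter hW')
    (φ := φ - d k (extend e ψ)) (sub_mem hφ.1 (d_mem_rc hx)) (fun τ hτ => by
      obtain ⟨σ, rfl⟩ := exists_lift_simplex he.isEmbedding (hτ.trans Set.inter_subset_left)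
      have h1 : pull e (k + 1) (φ - d k (extend e ψ)) = α := by
        rw [map_sub, ← d_pull, pull_extend he.injective, ← hsum, add_sub_cancel_right]
      refine (congrFun h1 σ).trans (hα.1 σ ?_)
      rintro _ ⟨t, rfl⟩
      exact (hτ ⟨t, rfl⟩).2) (by rw [hd]; exact zero_mem _)
  rw [hV] at hθ'
  refine Submodule.mem_sup.2 ⟨_, ⟨hθ', ?_⟩, d k (extend e ψ + θ), ⟨_, add_mem hx hθ, rfl⟩, ?_⟩
  · rw [SetLike.mem_coe, LinearMap.mem_ker, map_sub, hd, d_d, sub_zero]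
  · rw [map_add]; abel

lemma mem_rb_of_pull (he : Topology.IsOpenEmbedding e) {W : Set X} (hW : IsOpen W)
    (hcover : Wᶜ ⊆ Set.range e) {k : ℕ} {φ : Cochain X (k + 1)} (hφ : φ ∈ rz W (k + 1))
    (h : pull e (k + 1) φ ∈ rb (e ⁻¹' W) k) : φ ∈ rb W k := by
  have := mem_rz_sup_rb_of_pull he hW isOpen_univ (Set.subset_univ _)
    (fun x _ => (em (x ∈ W)).imp_right fun hx => hcover hx) hφ (Submodule.mem_sup_right h)
  rwa [rz_univ, bot_sup_eq] at this

lemma rz_le_rb_of_preimage (he : Topology.IsOpenEmbedding e) {W : Set X} (hW : IsOpen W)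
    (hcover : Wᶜ ⊆ Set.range e) {k : ℕ} (h : rz (e ⁻¹' W) (k + 1) ≤ rb (e ⁻¹' W) k) :
    rz W (k + 1) ≤ rb W k := fun _ hφ =>
  mem_rb_of_pull he hW hcover hφ (h (pull_mem_rz e (fun _ h => h) hφ))

lemma Detected.of_preimage (he : Topology.IsOpenEmbedding e) {W : Set X} (hW : IsOpen W)
    (hcover : Wᶜ ⊆ Set.range e) {k : ℕ} (h : Detected (e ⁻¹' W) k) : Detected W k := by
  intro φ hφ hc
  refine mem_rb_of_pull he hW hcover hφ (h _ (pull_mem_rz e (fun _ h => h) hφ) fun c hc' => ?_)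
  rw [← eval_push]
  refine hc _ ?_
  rw [bd_push]
  exact push_mem_chainsIn e (fun _ h => h) hc'

end Excision

end SingularChain

/-! ### Cohomology of Euclidean space relative to complements. -/

namespace SingularChain

open OrderedChain ConvexComb

section Euclidean

variable {E : Type*} [NormedAddCommGroup E] [NormedSpace ℝ E]

/-- The straight-line contraction onto a point. -/
noncomputable def lineHomotopy (p : E) :
    (ContinuousMap.id E).Homotopy (ContinuousMap.const E p) where
  toFun z := (1 - (z.1 : ℝ)) • z.2 + (z.1 : ℝ) • p
  continuous_toFun := by fun_prop
  map_zero_left x := by simp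
  map_one_left x := by simp

lemma lineHomotopy_apply (p : E) (t : unitInterval) (x : E) :
    lineHomotopy p (t, x) = (1 - (t : ℝ)) • x + (t : ℝ) • p := rfl

lemma lineHomotopy_mem {W : Set E} {p : E} (hW : StarConvex ℝ p W) (t : unitInterval) (x : E)
    (hx : x ∈ W) : lineHomotopy p (t, x) ∈ W := by
  rw [lineHomotopy_apply, add_comm]
  exact hW hx t.2.1 (sub_nonneg.2 t.2.2) (by ring)

/-- Pushing the complement of the centre of a bounded star-shaped set radially off the set. -/
theorem rz_compl_star_le {B : Set E} (hB : IsClosed B) (hb : Bornology.IsBounded B) {x : E}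
    (hx : x ∈ B) (hs : StarConvex ℝ x B) (k : ℕ) :
    rz Bᶜ (k + 1) ≤ rz {x}ᶜ (k + 1) ⊔ rb Bᶜ k := by
  obtain ⟨R, hR⟩ := hb.subset_closedBall x
  have hR0 : 0 ≤ R := by simpa using hR hx
  let Y : Set E := {x}ᶜ
  have hne : ∀ y : Y, ‖(y : E) - x‖ ≠ 0 := fun y => norm_ne_zero_iff.2 (sub_ne_zero.2 y.2)
  -- At time `t` the distance to `x` has grown by `t * R`; at time `1` it exceeds `R`, so the point
  -- is off `B`.
  let h : C(unitInterval × Y, E) :=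
    ⟨fun z => x + (1 + (z.1 : ℝ) * (R / ‖(z.2 : E) - x‖)) • ((z.2 : E) - x), by
      have h1 : Continuous fun z : unitInterval × Y => R / ‖(z.2 : E) - x‖ :=
        continuous_const.div (by fun_prop) fun z => hne z.2
      fun_prop⟩
  let e : C(Y, E) := ⟨Subtype.val, continuous_subtype_val⟩
  let g : C(Y, E) := h.comp ((ContinuousMap.const Y 1).prodMk (ContinuousMap.id Y))
  have happ : ∀ t y, h (t, y) = x + (1 + (t : ℝ) * (R / ‖(y : E) - x‖)) • ((y : E) - x) :=
    fun _ _ => rfl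
  let H : e.Homotopy g :=
    { toContinuousMap := h
      map_zero_left := fun y => by
        change h (0, y) = (y : E)
        rw [happ]; simp
      map_one_left := fun y => rfl }
  have he : Topology.IsOpenEmbedding e := isOpen_compl_singleton.isOpenEmbedding_subtypeVal
  have hg : ∀ y, g y ∉ B := fun y hy => by
    have := hR hy
    have hgy : g y = x + (1 + (1 : ℝ) * (R / ‖(y : E) - x‖)) • ((y : E) - x) := happ 1 y
    have hpos : 0 < ‖(y : E) - x‖ := (norm_nonneg _).lt_of_ne' (hne y)
    rw [Metric.mem_closedBall, dist_eq_norm, hgy, add_sub_cancel_left, norm_smul,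
      Real.norm_of_nonneg (by positivity), one_mul, add_mul, div_mul_cancel₀ _ (hne y)] at this
    linarith
  intro φ hφ
  -- After excising `x` the radial homotopy ends off `B`, so there the restricted cocycle is a
  -- coboundary relative to `Bᶜ`.
  refine mem_rz_sup_rb_of_pull he hB.isOpen_compl isOpen_compl_singleton
    (Set.compl_subset_compl.2 (Set.singleton_subset_iff.2 hx)) ?_ hφ (Submodule.mem_sup_right ?_)
  · intro y hy
    exact Or.inr ⟨⟨y, hy⟩, rfl⟩
  · have := exists_pull_sub_pull_eq H (V := e ⁻¹' Bᶜ) (W := Bᶜ) (fun t y hy hz => hy ?_) hφ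
    · have h0 : pull g (k + 1) φ = 0 := by
        funext σ
        refine hφ.1 _ ?_
        rintro _ ⟨t, rfl⟩
        exact hg _
      rw [h0, zero_sub] at this
      exact neg_mem_iff.1 this
    · have hz' : h (t, y) ∈ B := hz
      rw [happ] at hz'
      set s : ℝ := 1 + (t : ℝ) * (R / ‖(y : E) - x‖) with hs'
      have h1 : 1 ≤ s := by
        have : 0 ≤ (t : ℝ) * (R / ‖(y : E) - x‖) := mul_nonneg t.2.1 (by positivity)
        linarith
      -- Shrinking by `s⁻¹` towards the centre recovers `y`, so a path starting off `B` never enters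
      -- it.
      have := hs.add_smul_mem hz' (t := s⁻¹) (by positivity) (inv_le_one_of_one_le₀ h1)
      rw [smul_smul, inv_mul_cancel₀ (by positivity), one_smul, add_sub_cancel] at this
      exact this

end Euclidean

/-! ### Local cohomology of a point, along a flag of subspaces. -/

section LinearFlag

variable (m : ℕ)

/-- The complement of the subspace on which the first `k` coordinates vanish. -/
def flagCompl (k : ℕ) : Set (EuclideanSpace ℝ (Fin m)) := {x | ∃ i : Fin m, (i : ℕ) < k ∧ x i ≠ 0}

/-- The two halves into which `flagCompl m (k + 1)` decomposes. -/
def flagHalf (k : Fin m) (ε : ℝ) : Set (EuclideanSpace ℝ (Fin m)) :=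
  {x | (∃ i : Fin m, (i : ℕ) < k ∧ x i ≠ 0) ∨ 0 < ε * x k}

variable {m}

lemma isOpen_flagHalf (k : Fin m) (ε : ℝ) : IsOpen (flagHalf m k ε) := by
  have : flagHalf m k ε = (⋃ i : Fin m, ⋃ _ : (i : ℕ) < k, {x | x i ≠ 0}) ∪ {x | 0 < ε * x k} := by
    ext x; simp [flagHalf]
  rw [this]
  refine IsOpen.union (isOpen_iUnion fun i => isOpen_iUnion fun _ => ?_) ?_
  · exact isOpen_ne_fun (by fun_prop) continuous_const
  · exact isOpen_lt continuous_const (by fun_prop)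

lemma flagHalf_union (k : Fin m) : flagHalf m k 1 ∪ flagHalf m k (-1) = flagCompl m (k + 1) := by
  ext x
  simp only [flagHalf, flagCompl, Set.mem_union, Set.mem_ofPred_eq, one_mul, neg_one_mul, neg_pos]
  constructor
  · rintro ((⟨i, hi, h⟩ | h) | (⟨i, hi, h⟩ | h))
    exacts [⟨i, by omega, h⟩, ⟨k, by omega, h.ne'⟩, ⟨i, by omega, h⟩, ⟨k, by omega, h.ne⟩]
  · rintro ⟨i, hi, h⟩
    rcases Nat.lt_succ_iff_lt_or_eq.1 hi with hi | hi
    · exact Or.inl (Or.inl ⟨i, hi, h⟩)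
    · obtain rfl : i = k := Fin.ext hi
      rcases lt_or_gt_of_ne h with h | h
      exacts [Or.inr (Or.inr h), Or.inl (Or.inr h)]

lemma flagHalf_inter (k : Fin m) : flagHalf m k 1 ∩ flagHalf m k (-1) = flagCompl m k := by
  ext x
  simp only [flagHalf, flagCompl, Set.mem_inter_iff, Set.mem_ofPred_eq, one_mul, neg_one_mul,
    neg_pos]
  constructor
  · rintro ⟨h | h, h' | h'⟩
    exacts [h, h, h', (lt_asymm h h').elim]
  · exact fun h => ⟨Or.inl h, Or.inl h⟩

lemma single_mem_flagHalf (k : Fin m) {ε : ℝ} (hε : ε ≠ 0) :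
    EuclideanSpace.single k ε ∈ flagHalf m k ε := Or.inr (by simpa using mul_self_pos.2 hε)

/-- The centre has only its `k`th coordinate nonzero, so earlier coordinates are just multiplied by
`b`; `b = 0` gives the centre itself. -/
lemma starConvex_flagHalf (k : Fin m) {ε : ℝ} (hε : ε ≠ 0) :
    StarConvex ℝ (EuclideanSpace.single k ε) (flagHalf m k ε) := by
  intro y hy a b ha hb hab
  rcases hb.eq_or_lt with rfl | hb'
  · obtain rfl : a = 1 := by linarith
    simpa using single_mem_flagHalf k hε
  · rcases hy with ⟨i, hi, h⟩ | h
    · refine Or.inl ⟨i, hi, ?_⟩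
      have : i ≠ k := fun h => by simp [h] at hi
      simp [this, hb'.ne', h]
    · refine Or.inr ?_
      have h1 : ε * (a • EuclideanSpace.single k ε + b • y) k = a * (ε * ε) + b * (ε * y k) := by
        simp; ring
      rw [h1]
      have := mul_pos hb' h
      have := mul_nonneg ha (mul_self_nonneg ε)
      linarith

lemma rz_flagHalf_le (k : Fin m) {ε : ℝ} (hε : ε ≠ 0) (l : ℕ) :
    rz (flagHalf m k ε) (l + 1) ≤ rb (flagHalf m k ε) l :=
  rz_le_rb_of_contraction (lineHomotopy _) (single_mem_flagHalf k hε)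
    (lineHomotopy_mem (starConvex_flagHalf k hε)) l

lemma bounding_flagHalf (k : Fin m) {ε : ℝ} (hε : ε ≠ 0) (l : ℕ) :
    Bounding (flagHalf m k ε) l :=
  bounding_of_contraction (lineHomotopy _) (single_mem_flagHalf k hε)
    (lineHomotopy_mem (starConvex_flagHalf k hε)) l

lemma flagCompl_zero : flagCompl m 0 = ∅ := by ext; simp [flagCompl]

lemma flagCompl_self : flagCompl m m = {0}ᶜ := by
  ext x
  simp only [flagCompl, Set.mem_ofPred_eq, Set.mem_compl_iff, Set.mem_singleton_iff]
  constructor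
  · rintro ⟨i, -, h⟩ rfl
    exact h rfl
  · intro h
    by_contra! h'
    exact h (PiLp.ext fun i => h' i i.2)

/-- Induction on the codimension: the complement for `k + 1` is the union of two star-shaped halves
meeting in the complement for `k`, so Mayer–Vietoris raises the degree by one. For `k = 0` the
ambient space is contractible. -/
lemma rz_flagCompl_le {k : ℕ} (hk : k ≤ m) {l : ℕ} (hl : k ≤ l) :
    rz (flagCompl m k) (l + 2) ≤ rb (flagCompl m k) (l + 1) := by
  induction k generalizing l with
  | zero => rw [flagCompl_zero]; exact rz_empty_le_rb_of_contraction (lineHomotopy 0) l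
  | succ k ih =>
    obtain ⟨l, rfl⟩ : ∃ j, l = j + 1 := ⟨l - 1, by omega⟩
    have := rz_union_le (isOpen_flagHalf ⟨k, hk⟩ 1) (isOpen_flagHalf ⟨k, hk⟩ (-1))
      (rz_flagHalf_le _ one_ne_zero (l + 2)) (rz_flagHalf_le _ (neg_ne_zero.2 one_ne_zero) (l + 2))
      (by rw [flagHalf_inter]; exact ih (by omega) (by omega))
    rwa [flagHalf_union] at this

lemma detected_flagCompl {k : ℕ} (hk : k ≤ m) : Detected (flagCompl m k) k := by
  induction k with
  | zero =>
    -- Every chain of points is a cycle relative to `∅`, as its boundary lives on the empty simplex.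
    -- So `φ` vanishes at each point.
    intro φ _ hc
    have : φ = 0 := funext fun σ => by
      rw [← eval_of φ]
      refine hc _ ((Finsupp.mem_supported _ _).2 fun τ _ => ?_)
      rintro _ ⟨t, rfl⟩
      have := stdSimplex.sum_eq_one t
      simp at this
    rw [this]; exact zero_mem _
  | succ k ih =>
    have := Detected.union (isOpen_flagHalf ⟨k, hk⟩ 1) (isOpen_flagHalf ⟨k, hk⟩ (-1))
      (rz_flagHalf_le _ one_ne_zero (k + 1)) (rz_flagHalf_le _ (neg_ne_zero.2 one_ne_zero) (k + 1))
      (bounding_flagHalf _ one_ne_zero k) (bounding_flagHalf _ (neg_ne_zero.2 one_ne_zero) k)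
      (by rw [flagHalf_inter]; exact ih (by omega))
    rwa [flagHalf_union] at this

/-- The translation by `x`. -/
noncomputable def translation (x : EuclideanSpace ℝ (Fin m)) :
    C(EuclideanSpace ℝ (Fin m), EuclideanSpace ℝ (Fin m)) :=
  ⟨fun y => x + y, by fun_prop⟩

lemma isOpenEmbedding_translation (x : EuclideanSpace ℝ (Fin m)) :
    Topology.IsOpenEmbedding (translation x) := (Homeomorph.addLeft x).isOpenEmbedding

lemma translation_preimage (x : EuclideanSpace ℝ (Fin m)) :
    translation x ⁻¹' {x}ᶜ = flagCompl m m := by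
  rw [flagCompl_self]; ext y; simp [translation]

lemma compl_subset_range_translation (x : EuclideanSpace ℝ (Fin m))
    (s : Set (EuclideanSpace ℝ (Fin m))) : s ⊆ Set.range (translation x) := fun y _ =>
  (Homeomorph.addLeft x).surjective y

lemma rz_compl_point_le (x : EuclideanSpace ℝ (Fin m)) {l : ℕ} (hl : m ≤ l) :
    rz {x}ᶜ (l + 2) ≤ rb {x}ᶜ (l + 1) := by
  refine rz_le_rb_of_preimage (isOpenEmbedding_translation x) isOpen_compl_singleton
    (compl_subset_range_translation x _) ?_
  rw [translation_preimage]
  exact rz_flagCompl_le le_rfl hl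

lemma detected_compl_point (x : EuclideanSpace ℝ (Fin m)) : Detected ({x}ᶜ : Set _) m := by
  refine Detected.of_preimage (isOpenEmbedding_translation x) isOpen_compl_singleton
    (compl_subset_range_translation x _) ?_
  rw [translation_preimage]
  exact detected_flagCompl le_rfl

lemma rz_compl_convex_le {B : Set (EuclideanSpace ℝ (Fin m))} (hB : IsCompact B)
    (hc : Convex ℝ B) {l : ℕ} (hl : m ≤ l) : rz Bᶜ (l + 2) ≤ rb Bᶜ (l + 1) := by
  rcases B.eq_empty_or_nonempty with rfl | ⟨x, hx⟩
  · rw [Set.compl_empty, rz_univ]; exact bot_le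
  · refine (rz_compl_star_le hB.isClosed hB.isBounded hx (hc.starConvex hx) _).trans
      (sup_le ((rz_compl_point_le x hl).trans (rb_anti ?_ _)) le_rfl)
    exact Set.compl_subset_compl.2 (Set.singleton_subset_iff.2 hx)

/-- Above the dimension there is no cohomology relative to the complement of a finite union of
compact convex sets. -/
theorem rz_compl_biUnion_le {ι : Type*} (F : Finset ι) {B : ι → Set (EuclideanSpace ℝ (Fin m))}
    (hB : ∀ i, IsCompact (B i)) (hc : ∀ i, Convex ℝ (B i)) {l : ℕ} (hl : m ≤ l) :
    rz (⋃ i ∈ F, B i)ᶜ (l + 2) ≤ rb (⋃ i ∈ F, B i)ᶜ (l + 1) := by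
  classical
  induction F using Finset.induction_on generalizing B l with
  | empty => simp only [Finset.notMem_empty, Set.iUnion_of_empty, Set.iUnion_empty,
      Set.compl_empty, rz_univ]; exact bot_le
  | insert a F ha ih =>
    have hF : IsCompact (⋃ i ∈ F, B i) := F.isCompact_biUnion fun i _ => hB i
    -- The overlap of `B a` with the union over `F` is again a union over `F` of compact convex
    -- sets, but it is needed one degree higher; hence the induction generalizes `B` and `l`.
    have := rz_inter_le (hB a).isClosed.isOpen_compl hF.isClosed.isOpen_compl (k := l + 2) (by
      rw [← Set.compl_inter, Set.inter_iUnion₂]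
      exact ih (fun i => (hB a).inter (hB i)) (fun i => (hc a).inter (hc i)) (by omega))
    rw [Finset.set_biUnion_insert, Set.compl_union]
    refine this.trans (sup_le ((rz_compl_convex_le (hB a) (hc a) hl).trans (rb_anti ?_ _))
      ((ih hB hc hl).trans (rb_anti ?_ _)))
    exacts [Set.inter_subset_left, Set.inter_subset_right]

end LinearFlag

end SingularChain

/-! ### Top cohomology of manifolds by supports. -/

namespace SingularChain

open OrderedChain ConvexComb

variable {m : ℕ}

lemma exists_biUnion_convex {C O : Set (EuclideanSpace ℝ (Fin m))} (hC : IsCompact C)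
    (hO : IsOpen O) (h : C ⊆ O) :
    ∃ (F : Finset (EuclideanSpace ℝ (Fin m))) (B : EuclideanSpace ℝ (Fin m) → Set _),
      (∀ i, IsCompact (B i)) ∧ (∀ i, Convex ℝ (B i)) ∧ C ⊆ ⋃ i ∈ F, B i ∧ ⋃ i ∈ F, B i ⊆ O := by
  have hr : ∀ x, ∃ r > 0, x ∈ C → Metric.closedBall x r ⊆ O := fun x => by
    by_cases hx : x ∈ C
    · obtain ⟨r, hr, h'⟩ := Metric.nhds_basis_closedBall.mem_iff.1 (hO.mem_nhds (h hx))
      exact ⟨r, hr, fun _ => h'⟩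
    · exact ⟨1, one_pos, fun h => (hx h).elim⟩
  choose r hr h' using hr
  obtain ⟨F, hF, hCF⟩ := hC.elim_nhds_subcover (fun x => Metric.closedBall x (r x))
    fun x _ => Metric.closedBall_mem_nhds x (hr x)
  exact ⟨F, fun x => Metric.closedBall x (r x), fun x => isCompact_closedBall _ _,
    fun x => convex_closedBall _ _, hCF, Set.iUnion₂_subset fun i hi => h' i (hF i hi)⟩

variable {N : Type*} [TopologicalSpace N]

/-- The cocycles cohomologous to one vanishing off the point `x`. -/
noncomputable def supportedAt (m : ℕ) (x : N) : Submodule ℤ (Cochain N (m + 1)) :=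
  rz {x}ᶜ (m + 1) ⊔ rb ∅ m

section Chart

lemma isOpen_compl_image [T2Space N] {e : C(EuclideanSpace ℝ (Fin m), N)}
    {B : Set (EuclideanSpace ℝ (Fin m))} (hB : IsCompact B) : IsOpen (e '' B)ᶜ :=
  (hB.image e.continuous).isClosed.isOpen_compl

lemma preimage_compl_image {e : C(EuclideanSpace ℝ (Fin m), N)} (he : Topology.IsOpenEmbedding e)
    (B : Set (EuclideanSpace ℝ (Fin m))) : e ⁻¹' (e '' B)ᶜ = Bᶜ := by
  rw [Set.preimage_compl, Set.preimage_image_eq _ he.injective]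

variable [T2Space N] {e : C(EuclideanSpace ℝ (Fin m), N)} (he : Topology.IsOpenEmbedding e)

include he

/-- By excision the question moves into the chart, where the radial push concentrates the support at
`x`. -/
lemma rz_compl_image_convex_le {B : Set (EuclideanSpace ℝ (Fin m))} (hB : IsCompact B)
    (hc : Convex ℝ B) {x : EuclideanSpace ℝ (Fin m)} (hx : x ∈ B) :
    rz (e '' B)ᶜ (m + 1) ≤ supportedAt m (e x) := by
  intro φ hφ
  have h : φ ∈ rz {e x}ᶜ (m + 1) ⊔ rb (e '' B)ᶜ m := by
    refine mem_rz_sup_rb_of_pull he (isOpen_compl_image hB) isOpen_compl_singleton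
      (Set.compl_subset_compl.2 (Set.singleton_subset_iff.2 ⟨x, hx, rfl⟩)) ?_ hφ ?_
    · intro y _
      by_cases hy : y ∈ e '' B
      · exact Or.inr (Set.image_subset_range _ _ hy)
      · exact Or.inl hy
    · have h1 : e ⁻¹' {e x}ᶜ = {x}ᶜ := by
        rw [← preimage_compl_image he, Set.image_singleton]
      rw [preimage_compl_image he, h1]
      refine rz_compl_star_le hB.isClosed hB.isBounded hx (hc.starConvex hx) m
        (pull_mem_rz e (fun y hy => ?_) hφ)
      rwa [← preimage_compl_image he] at hy
  exact (sup_le_sup_left (rb_anti (Set.empty_subset _) _) _ : _ ≤ supportedAt m (e x)) h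

/-- A cocycle supported at one end of a segment is supported on the segment, which is compact and
convex, and concentrates at the other end. -/
lemma supportedAt_le (x y : EuclideanSpace ℝ (Fin m)) :
    supportedAt m (e x) ≤ supportedAt m (e y) := by
  have hseg : segment ℝ x y = AffineMap.lineMap x y '' Set.Icc (0 : ℝ) 1 :=
    segment_eq_image_lineMap ℝ x y
  have hB : IsCompact (segment ℝ x y) := by
    rw [hseg]; exact isCompact_Icc.image (AffineMap.lineMap_continuous)
  refine sup_le ((rz_anti ?_ _).trans (rz_compl_image_convex_le he hB (convex_segment x y)
    (right_mem_segment ℝ x y))) le_sup_right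
  exact Set.compl_subset_compl.2 (Set.singleton_subset_iff.2 ⟨x, left_mem_segment ℝ x y, rfl⟩)

lemma rz_compl_image_biUnion_le {ι : Type*} (F : Finset ι)
    {B : ι → Set (EuclideanSpace ℝ (Fin m))} (hB : ∀ i, IsCompact (B i))
    (hc : ∀ i, Convex ℝ (B i)) {l : ℕ} (hl : m ≤ l) :
    rz (e '' ⋃ i ∈ F, B i)ᶜ (l + 2) ≤ rb (e '' ⋃ i ∈ F, B i)ᶜ (l + 1) := by
  refine rz_le_rb_of_preimage he (isOpen_compl_image (F.isCompact_biUnion fun i _ => hB i))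
    (by rw [compl_compl]; exact Set.image_subset_range _ _) ?_
  rw [preimage_compl_image he]
  exact rz_compl_biUnion_le F hB hc hl

lemma rz_compl_image_biUnion_le_iSup {ι : Type*} (F : Finset ι)
    {B : ι → Set (EuclideanSpace ℝ (Fin m))} (hB : ∀ i, IsCompact (B i))
    (hc : ∀ i, Convex ℝ (B i)) :
    rz (e '' ⋃ i ∈ F, B i)ᶜ (m + 1) ≤ ⨆ x, supportedAt m x := by
  classical
  induction F using Finset.induction_on with
  | empty => simp [rz_univ]
  | insert a F ha ih =>
    have hF : IsCompact (⋃ i ∈ F, B i) := F.isCompact_biUnion fun i _ => hB i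
    have := rz_inter_le (isOpen_compl_image (hB a)) (isOpen_compl_image hF) (k := m + 1) (by
      rw [← Set.compl_inter, ← Set.image_inter he.injective, Set.inter_iUnion₂]
      exact rz_compl_image_biUnion_le he F (fun i => (hB a).inter (hB i))
        (fun i => (hc a).inter (hc i)) le_rfl)
    rw [Finset.set_biUnion_insert, Set.image_union, Set.compl_union]
    refine this.trans (sup_le ?_ ih)
    rcases (B a).eq_empty_or_nonempty with h | ⟨x, hx⟩
    · simp [h, rz_univ]
    · exact (rz_compl_image_convex_le he (hB a) (hc a) hx).trans (le_iSup (supportedAt m) (e x))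

lemma rz_compl_le_iSup_of_subset_range {K : Set N} (hK : IsCompact K) (h : K ⊆ Set.range e) :
    rz Kᶜ (m + 1) ≤ ⨆ x, supportedAt m x := by
  have hK' : IsCompact (e ⁻¹' K) := (he.isInducing.isCompact_preimage_iff h).2 hK
  obtain ⟨F, B, hB, hc, hKB, -⟩ := exists_biUnion_convex hK' isOpen_univ (Set.subset_univ _)
  refine (rz_anti ?_ _).trans (rz_compl_image_biUnion_le_iSup he F hB hc)
  refine Set.compl_subset_compl.2 fun y hy => ?_
  obtain ⟨x, rfl⟩ := h hy
  exact ⟨x, hKB hy, rfl⟩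

lemma rz_compl_le_iSup_union {U : Set N} (hU : IsOpen U)
    (h : ∀ K, IsCompact K → K ⊆ U → rz Kᶜ (m + 1) ≤ ⨆ x, supportedAt m x) {K : Set N}
    (hK : IsCompact K) (hKU : K ⊆ U ∪ Set.range e) : rz Kᶜ (m + 1) ≤ ⨆ x, supportedAt m x := by
  obtain ⟨K₁, K₂, hK₁, hK₂, hKU₁, hKU₂, rfl⟩ :=
    hK.binary_compact_cover hU he.isOpen_range hKU
  have hC : IsCompact (e ⁻¹' (K₁ ∩ K₂)) := (he.isInducing.isCompact_preimage_iff
    (Set.inter_subset_right.trans hKU₂)).2 (hK₁.inter hK₂)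
  -- `K₁ ∩ K₂` is an arbitrary compact set, for which no vanishing is known. Both pieces are
  -- enlarged by a finite union of balls, so that they meet exactly in `e '' P`.
  obtain ⟨F, B, hB, hc, hCB, hBU⟩ := exists_biUnion_convex hC (hU.preimage e.continuous)
    (Set.preimage_mono (Set.inter_subset_left.trans hKU₁))
  set P := ⋃ i ∈ F, B i with hP
  have hPc : IsCompact P := F.isCompact_biUnion fun i _ => hB i
  have hL₁ : IsCompact (K₁ ∪ e '' P) := hK₁.union (hPc.image e.continuous)
  have hL₂ : IsCompact (K₂ ∪ e '' P) := hK₂.union (hPc.image e.continuous)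
  have hL : (K₁ ∪ e '' P) ∩ (K₂ ∪ e '' P) = e '' P := by
    rw [← Set.inter_union_distrib_right]
    refine Set.union_eq_right.2 fun y hy => ?_
    obtain ⟨x, rfl⟩ := hKU₂ hy.2
    exact ⟨x, hCB hy, rfl⟩
  have := rz_inter_le hL₁.isClosed.isOpen_compl hL₂.isClosed.isOpen_compl (k := m + 1) (by
    rw [← Set.compl_inter, hL]
    exact rz_compl_image_biUnion_le he F hB hc le_rfl)
  refine (rz_anti ?_ _).trans (this.trans (sup_le
    (h _ hL₁ (Set.union_subset hKU₁ (Set.image_subset_iff.2 hBU)))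
    (rz_compl_le_iSup_of_subset_range he hL₂
      (Set.union_subset hKU₂ (Set.image_subset_range _ _)))))
  rw [← Set.compl_union]
  exact Set.compl_subset_compl.2 (Set.union_subset_union Set.subset_union_left
    Set.subset_union_left)

end Chart

variable
  (hN : ∀ x : N, ∃ e : C(EuclideanSpace ℝ (Fin m), N), Topology.IsOpenEmbedding e ∧
    x ∈ Set.range e)

include hN

/-- The cohomology of a closed manifold in the top degree is generated by classes supported at
points. -/
theorem rz_empty_le_iSup_supportedAt [T2Space N] [CompactSpace N] :
    rz ∅ (m + 1) ≤ ⨆ x : N, supportedAt m x := by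
  -- Compactness induction needs a property stable under unions: that adjoining `U` to any good open
  -- set gives a good open set. Goodness of `U` alone is not known to be stable.
  have key : ∃ U : Set N, Set.univ ⊆ U ∧ ∀ U', IsOpen U' →
      (∀ K, IsCompact K → K ⊆ U' → rz Kᶜ (m + 1) ≤ ⨆ x, supportedAt m x) →
      IsOpen (U' ∪ U) ∧
      (∀ K, IsCompact K → K ⊆ U' ∪ U → rz Kᶜ (m + 1) ≤ ⨆ x, supportedAt m x) := by
    refine isCompact_univ.induction_on (p := fun s : Set N => ∃ U : Set N, s ⊆ U ∧ ∀ U', IsOpen U' →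
      (∀ K, IsCompact K → K ⊆ U' → rz Kᶜ (m + 1) ≤ ⨆ x, supportedAt m x) →
      IsOpen (U' ∪ U) ∧
      (∀ K, IsCompact K → K ⊆ U' ∪ U → rz Kᶜ (m + 1) ≤ ⨆ x, supportedAt m x)) ?_ ?_ ?_ ?_
    · exact ⟨∅, Set.empty_subset _, fun U' hU' h => by rw [Set.union_empty]; exact ⟨hU', h⟩⟩
    · rintro s t hst ⟨U, hU, h⟩
      exact ⟨U, hst.trans hU, h⟩
    · rintro s t ⟨U, hU, h⟩ ⟨V, hV, h'⟩
      refine ⟨U ∪ V, Set.union_subset_union hU hV, fun U' hU' hK => ?_⟩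
      rw [← Set.union_assoc]
      exact h' _ (h U' hU' hK).1 (h U' hU' hK).2
    · intro x _
      obtain ⟨e, he, hx⟩ := hN x
      exact ⟨Set.range e, mem_nhdsWithin_of_mem_nhds (he.isOpen_range.mem_nhds hx), _,
        subset_rfl, fun U' hU' h => ⟨hU'.union he.isOpen_range, fun K hK hKU =>
          rz_compl_le_iSup_union he hU' h hK hKU⟩⟩
  obtain ⟨U, hU, h⟩ := key
  have := (h ∅ isOpen_empty (fun K _ hK => by
    rw [Set.subset_empty_iff.1 hK, Set.compl_empty, rz_univ]; exact bot_le)).2 Set.univ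
    isCompact_univ (hU.trans Set.subset_union_right)
  rwa [Set.compl_univ] at this

lemma supportedAt_eq_of_mem_connectedComponent [T2Space N] {x y : N} (h : y ∈ connectedComponent x) :
    supportedAt m y = supportedAt m x := by
  have hlc : IsLocallyConstant fun y : N => supportedAt m y := by
    refine (IsLocallyConstant.iff_exists_open _).2 fun x => ?_
    obtain ⟨e, he, a, rfl⟩ := hN x
    refine ⟨Set.range e, he.isOpen_range, ⟨a, rfl⟩, ?_⟩
    rintro _ ⟨b, rfl⟩
    exact le_antisymm (supportedAt_le he _ _) (supportedAt_le he _ _)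
  exact hlc.apply_eq_of_isPreconnected isPreconnected_connectedComponent h mem_connectedComponent

lemma isClopen_connectedComponent_of_charts (x : N) : IsClopen (connectedComponent x) := by
  refine ⟨isClosed_connectedComponent, isOpen_iff_mem_nhds.2 fun y hy => ?_⟩
  obtain ⟨e, he, hye⟩ := hN y
  refine Filter.mem_of_superset (he.isOpen_range.mem_nhds hye) ?_
  rw [connectedComponent_eq hy]
  exact (isPreconnected_range e.continuous).subset_connectedComponent hye

/-! ### Restriction to clopen sets and detection on components. -/

omit hN

/-- The restriction of a cochain to the simplices contained in a set, extended by zero. -/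
noncomputable def restrictTo (C : Set N) (k : ℕ) : Cochain N k →ₗ[ℤ] Cochain N k := by
  classical
  exact
  { toFun := fun φ σ => if Set.range σ ⊆ C then φ σ else 0
    map_add' := fun φ ψ => by
      funext σ
      by_cases h : Set.range σ ⊆ C <;> simp [h]
    map_smul' := fun c φ => by
      funext σ
      by_cases h : Set.range σ ⊆ C <;> simp [h] }

open Classical in
lemma restrictTo_apply (C : Set N) {k : ℕ} (φ : Cochain N k) (σ : C(stdSimplex ℝ (Fin k), N)) :
    restrictTo C k φ σ = if Set.range σ ⊆ C then φ σ else 0 := rfl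

lemma range_subset_of_mem {C : Set N} (hC : IsClopen C) {k : ℕ}
    (σ : C(stdSimplex ℝ (Fin (k + 1)), N)) {x : N} (hx : x ∈ Set.range σ) (hxC : x ∈ C) :
    Set.range σ ⊆ C :=
  (isPreconnected_range σ.continuous).subset_isClopen hC ⟨x, hx, hxC⟩

/-- A nonempty simplex is connected, so it lies in the clopen set exactly when any one of its faces
does. Degrees start at `k + 1` to exclude the empty simplex. -/
lemma d_restrictTo {C : Set N} (hC : IsClopen C) {k : ℕ} (φ : Cochain N (k + 1)) :
    d (k + 1) (restrictTo C (k + 1) φ) = restrictTo C (k + 2) (d (k + 1) φ) := by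
  funext σ
  have h : ∀ i, Set.range (face σ i) ⊆ C ↔ Set.range σ ⊆ C := fun i =>
    ⟨fun h => range_subset_of_mem hC σ (range_face_subset σ i ⟨stdSimplex.barycenter, rfl⟩)
      (h ⟨stdSimplex.barycenter, rfl⟩), fun h => (range_face_subset σ i).trans h⟩
  have h' : ∀ i, restrictTo C (k + 1) φ (face σ i) =
      open Classical in if Set.range σ ⊆ C then φ (face σ i) else 0 := fun i => by
    classical
    rw [restrictTo_apply, if_congr (h i) rfl rfl]
  rw [restrictTo_apply, d_apply, d_apply]
  simp only [h']
  split_ifs <;> simp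

/-- Simplices through `x` lie wholly inside or wholly outside `C`, so a cocycle supported at `x` is
either unchanged or killed. -/
lemma restrictTo_mem_supportedAt {C : Set N} (hC : IsClopen C) {k : ℕ} {x : N}
    {φ : Cochain N (k + 2)} (hφ : φ ∈ supportedAt (k + 1) x) :
    restrictTo C (k + 2) φ ∈ rb ∅ (k + 1) ∨
      x ∈ C ∧ restrictTo C (k + 2) φ ∈ supportedAt (k + 1) x := by
  obtain ⟨α, hα, _, ⟨ψ, -, rfl⟩, rfl⟩ := Submodule.mem_sup.1 hφ
  have hb : restrictTo C (k + 2) (d (k + 1) ψ) ∈ rb ∅ (k + 1) := by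
    rw [← d_restrictTo hC]
    exact ⟨_, fun σ hσ => (hσ ⟨stdSimplex.barycenter, rfl⟩).elim, rfl⟩
  rw [map_add]
  by_cases hx : x ∈ C
  · right
    refine ⟨hx, add_mem (Submodule.mem_sup_left ?_) (Submodule.mem_sup_right hb)⟩
    have : restrictTo C (k + 2) α = α := by
      funext σ
      rw [restrictTo_apply]
      split_ifs with h
      · rfl
      · refine (hα.1 σ fun y hy hyx => h ?_).symm
        exact range_subset_of_mem hC σ hy (by rwa [Set.mem_singleton_iff.1 hyx])
    rwa [this]
  · left
    have : restrictTo C (k + 2) α = 0 := by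
      funext σ
      rw [restrictTo_apply]
      split_ifs with h
      · exact hα.1 σ fun y hy hyx => hx (by rw [← Set.mem_singleton_iff.1 hyx]; exact h hy)
      · rfl
    rw [this, zero_add]
    exact hb

include hN in
/-- A cocycle of top degree on a closed manifold, all of whose restrictions to clopen sets are
annihilated by a functional `L` which detects the local cohomology at every point, is a
coboundary. -/
theorem mem_rb_of_functional [T2Space N] [CompactSpace N] (hm : m ≠ 0)
    (L : LinearMap.ker (d (X := N) (m + 1)) →ₗ[ℤ] ℤ)
    (hb : ∀ φ, φ.1 ∈ rb (∅ : Set N) m → L φ = 0)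
    (hz : ∀ x, ∀ φ, φ.1 ∈ rz {x}ᶜ (m + 1) → L φ = 0 → ∀ c, bd m c ∈ chainsIn {x}ᶜ m →
      eval φ.1 c = 0)
    (φ : LinearMap.ker (d (X := N) (m + 1)))
    (hφ : ∀ C : Set N, IsClopen C → ∀ ψ : LinearMap.ker (d (X := N) (m + 1)),
      ψ.1 = restrictTo C (m + 1) φ.1 → L ψ = 0) :
    φ.1 ∈ rb (∅ : Set N) m := by
  obtain ⟨m, rfl⟩ := Nat.exists_eq_succ_of_ne_zero hm
  have hd : LinearMap.ker (d (X := N) (m + 2)) = rz ∅ (m + 2) := by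
    refine le_antisymm (fun ψ hψ => ⟨fun σ hσ => ?_, hψ⟩) fun ψ hψ => hψ.2
    exact (hσ ⟨stdSimplex.barycenter, rfl⟩).elim
  have hcomp : ∀ x : N, restrictTo (connectedComponent x) (m + 2) φ.1 ∈
      rb (∅ : Set N) (m + 1) := by
    intro x
    have hC := isClopen_connectedComponent_of_charts hN x
    -- Generators at points of other components become coboundaries, and those on this component can
    -- all be moved to `x`.
    have hle : (⨆ y : N, supportedAt (m + 1) y) ≤
        (supportedAt (m + 1) x).comap (restrictTo (connectedComponent x) (m + 2)) := by
      refine iSup_le fun y α hα => ?_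
      rcases restrictTo_mem_supportedAt hC hα with h | ⟨hy, h⟩
      · exact Submodule.mem_sup_right h
      · rwa [supportedAt_eq_of_mem_connectedComponent hN hy] at h
    have hmem := hle (rz_empty_le_iSup_supportedAt hN (hd.le φ.2))
    obtain ⟨u, hu, v, hv, huv⟩ := Submodule.mem_sup.1 (Submodule.mem_comap.1 hmem)
    have hv' : v ∈ LinearMap.ker (d (X := N) (m + 2)) := (rb_le_rz _ _ hv).2
    have hL : L ⟨u, hu.2⟩ = 0 := by
      have h1 := hφ _ hC (⟨u, hu.2⟩ + ⟨v, hv'⟩) huv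
      rwa [map_add, hb ⟨v, hv'⟩ hv, add_zero] at h1
    obtain ⟨e, he, a, rfl⟩ := hN x
    have hdet : Detected ({e a}ᶜ : Set N) (m + 1) := by
      refine Detected.of_preimage he isOpen_compl_singleton ?_ ?_
      · rw [compl_compl, Set.singleton_subset_iff]
        exact ⟨a, rfl⟩
      · rw [← Set.image_singleton, preimage_compl_image he]
        exact detected_compl_point a
    rw [← huv]
    exact add_mem (rb_anti (Set.empty_subset _) _ (hdet u hu (hz _ ⟨u, hu.2⟩ hu hL))) hv
  choose ψ hψ hψ' using hcomp
  -- The primitives are chosen pointwise; passing to one representative per component makes a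
  -- simplex and its faces use the same one.
  let r : N → N := fun x => Quotient.out (x : ConnectedComponents N)
  have hr : ∀ x, connectedComponent (r x) = connectedComponent x := fun x =>
    ConnectedComponents.coe_eq_coe.1 (Quotient.out_eq _)
  let p : ∀ {k : ℕ}, C(stdSimplex ℝ (Fin (k + 1)), N) → N := fun σ => σ stdSimplex.barycenter
  have hp : ∀ (σ : C(stdSimplex ℝ (Fin (m + 2)), N)) i, r (p (face σ i)) = r (p σ) := by
    intro σ i
    have : ((p (face σ i) : N) : ConnectedComponents N) = (p σ : N) :=
      ConnectedComponents.coe_eq_coe'.2 ((isPreconnected_range σ.continuous).subset_connectedComponent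
        ⟨stdSimplex.barycenter, rfl⟩ (range_face_subset σ i ⟨stdSimplex.barycenter, rfl⟩))
    simp only [r, this]
  refine ⟨fun σ => ψ (r (p σ)) σ, fun σ hσ => (hσ ⟨stdSimplex.barycenter, rfl⟩).elim,
    funext fun σ => ?_⟩
  rw [d_apply]
  simp only [hp]
  rw [← d_apply, hψ', restrictTo_apply, if_pos]
  rw [hr]
  exact (isPreconnected_range σ.continuous).subset_connectedComponent ⟨_, rfl⟩

end SingularChain

/-! ### Pairing cocycles with homology classes. -/

namespace SingularChain

open Opposite Simplicial

variable {X Y : Type u} [TopologicalSpace X] [TopologicalSpace Y]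

/-- The singular simplices of a space as continuous maps on the affine standard simplex. -/
noncomputable def simplexEquiv (X : Type u) [TopologicalSpace X] (k : ℕ) :
    (TopCat.toSSet.obj (TopCat.of X)) _⦋k⦌ ≃ C(stdSimplex ℝ (Fin (k + 1)), X) :=
  TopCat.toSSetObjEquiv (TopCat.of X) (op ⦋k⦌)

lemma simplexEquiv_δ {k : ℕ} (s : (TopCat.toSSet.obj (TopCat.of X)) _⦋k + 1⦌) (i : Fin (k + 2)) :
    simplexEquiv X k ((TopCat.toSSet.obj (TopCat.of X)).δ i s) =
      face (simplexEquiv X (k + 1) s) i := rfl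

lemma simplexEquiv_map (f : C(X, Y)) {k : ℕ} (s : (TopCat.toSSet.obj (TopCat.of X)) _⦋k⦌) :
    simplexEquiv Y k ((TopCat.toSSet.map (TopCat.ofHom f)).app _ s) =
      f.comp (simplexEquiv X k s) := rfl


section Pairing

open HomologicalComplex IntegralHomology

/-- The coefficient module of singular homology. -/
abbrev Coeff : ModuleCat.{u} ℤ := ModuleCat.of ℤ (ULift.{u} ℤ)

variable {K L : ChainComplex (ModuleCat.{u} ℤ) ℕ}

/-- The map on homology induced by a homomorphism on chains that vanishes on boundaries. -/
noncomputable def pairing {k : ℕ} (φ : K.X k ⟶ Coeff.{u}) (h : K.d (k + 1) k ≫ φ = 0) :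
    K.homology k ⟶ Coeff.{u} :=
  K.homologyι k ≫ K.descOpcycles φ (k + 1) (by simp) h

lemma homologyπ_pairing {k : ℕ} (φ : K.X k ⟶ Coeff.{u}) (h : K.d (k + 1) k ≫ φ = 0) :
    K.homologyπ k ≫ pairing φ h = K.iCycles k ≫ φ := by
  rw [pairing, homology_π_ι_assoc, p_descOpcycles]

lemma pairing_congr {k : ℕ} {φ ψ : K.X k ⟶ Coeff.{u}} (e : φ = ψ) (h : K.d (k + 1) k ≫ φ = 0)
    (h' : K.d (k + 1) k ≫ ψ = 0) : pairing φ h = pairing ψ h' := by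
  subst e; rfl

lemma homologyMap_pairing (f : K ⟶ L) {k : ℕ} (φ : L.X k ⟶ Coeff.{u}) (h : L.d (k + 1) k ≫ φ = 0)
    (h' : K.d (k + 1) k ≫ f.f k ≫ φ = 0) :
    homologyMap f k ≫ pairing φ h = pairing (f.f k ≫ φ) h' := by
  rw [← cancel_epi (K.homologyπ k), homologyπ_naturality_assoc, homologyπ_pairing,
    homologyπ_pairing, cyclesMap_i_assoc]

lemma pairing_add {k : ℕ} (φ ψ : K.X k ⟶ Coeff.{u}) (h : K.d (k + 1) k ≫ φ = 0)
    (h' : K.d (k + 1) k ≫ ψ = 0) (h'' : K.d (k + 1) k ≫ (φ + ψ) = 0) :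
    pairing (φ + ψ) h'' = pairing φ h + pairing ψ h' := by
  rw [← cancel_epi (K.homologyπ k), Preadditive.comp_add, homologyπ_pairing, homologyπ_pairing,
    homologyπ_pairing, Preadditive.comp_add]

lemma pairing_d {k : ℕ} (φ : K.X k ⟶ Coeff.{u}) (h : K.d (k + 2) (k + 1) ≫ K.d (k + 1) k ≫ φ = 0) :
    pairing (K.d (k + 1) k ≫ φ) h = 0 := by
  rw [← cancel_epi (K.homologyπ (k + 1)), homologyπ_pairing, iCycles_d_assoc, Limits.zero_comp,
    Limits.comp_zero]

/-- A cochain as a homomorphism on singular chains. -/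
noncomputable def cochainHom {k : ℕ} (φ : Cochain X (k + 1)) :
    (chains (TopCat.of X)).X k ⟶ Coeff.{u} :=
  Limits.Sigma.desc fun s : (TopCat.toSSet.obj (TopCat.of X)) _⦋k⦌ => φ (simplexEquiv X k s) • 𝟙 _

/-- The inclusion of the summand of a singular simplex. -/
noncomputable abbrev ι {k : ℕ} (s : (TopCat.toSSet.obj (TopCat.of X)) _⦋k⦌) :
    Coeff.{u} ⟶ (chains (TopCat.of X)).X k :=
  SSet.ιChainComplex (R := Coeff.{u}) (TopCat.toSSet.obj (TopCat.of X)) s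

lemma ι_cochainHom {k : ℕ} (φ : Cochain X (k + 1))
    (s : (TopCat.toSSet.obj (TopCat.of X)) _⦋k⦌) :
    ι s ≫ cochainHom φ = φ (simplexEquiv X k s) • 𝟙 _ :=
  Limits.Sigma.ι_desc _ _

lemma chains_hom_ext {k : ℕ} {A : ModuleCat.{u} ℤ} {f g : (chains (TopCat.of X)).X k ⟶ A}
    (h : ∀ s : (TopCat.toSSet.obj (TopCat.of X)) _⦋k⦌, ι s ≫ f = ι s ≫ g) : f = g :=
  SSet.chainComplex_hom_ext h

lemma cochainHom_add {k : ℕ} (φ ψ : Cochain X (k + 1)) :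
    cochainHom (φ + ψ) = cochainHom φ + cochainHom ψ :=
  chains_hom_ext fun s => by
    rw [Preadditive.comp_add, ι_cochainHom, ι_cochainHom, ι_cochainHom, Pi.add_apply, add_smul]

lemma ι_d {k : ℕ} (s : (TopCat.toSSet.obj (TopCat.of X)) _⦋k + 1⦌) :
    ι s ≫ (chains (TopCat.of X)).d (k + 1) k =
      ∑ i : Fin (k + 2), (-1 : ℤ) ^ (i : ℕ) • ι ((TopCat.toSSet.obj (TopCat.of X)).δ i s) :=
  SSet.ιChainComplex_d _ _ s

lemma d_cochainHom {k : ℕ} (φ : Cochain X (k + 1)) :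
    (chains (TopCat.of X)).d (k + 1) k ≫ cochainHom φ = cochainHom (d (k + 1) φ) := by
  refine chains_hom_ext fun s => ?_
  rw [← Category.assoc, ι_d, ι_cochainHom, Preadditive.sum_comp, d_apply, Finset.sum_smul]
  refine Finset.sum_congr rfl fun i _ => ?_
  rw [Preadditive.zsmul_comp, ι_cochainHom, simplexEquiv_δ, mul_smul]

lemma ι_chainsMap (f : C(X, Y)) {k : ℕ} (s : (TopCat.toSSet.obj (TopCat.of X)) _⦋k⦌) :
    ι s ≫ (chainsMap (TopCat.ofHom f)).f k =
      ι ((TopCat.toSSet.map (TopCat.ofHom f)).app _ s) :=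
  SSet.ι_chainComplexMap_f _ _ _ _ s

lemma chainsMap_cochainHom (f : C(X, Y)) {k : ℕ} (φ : Cochain Y (k + 1)) :
    (chainsMap (TopCat.ofHom f)).f k ≫ cochainHom φ = cochainHom (pull f (k + 1) φ) := by
  refine chains_hom_ext fun s => ?_
  rw [← Category.assoc, ι_chainsMap, ι_cochainHom, ι_cochainHom, simplexEquiv_map]
  rfl

lemma cochainHom_zero {k : ℕ} : cochainHom (0 : Cochain X (k + 1)) = 0 :=
  chains_hom_ext fun s => by
    rw [ι_cochainHom, Limits.comp_zero, Pi.zero_apply, zero_smul]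

lemma d_cochainHom_eq_zero {k : ℕ} {φ : Cochain X (k + 1)} (h : d (k + 1) φ = 0) :
    (chains (TopCat.of X)).d (k + 1) k ≫ cochainHom φ = 0 := by
  rw [d_cochainHom, h, cochainHom_zero]

/-- A chain of affine simplices as an element of the singular chain complex. -/
noncomputable def chainHom (k : ℕ) :
    Chain X (k + 1) →ₗ[ℤ] (Coeff.{u} ⟶ (chains (TopCat.of X)).X k) :=
  lift fun σ => ι ((simplexEquiv X k).symm σ)

lemma chainHom_of {k : ℕ} (σ : C(stdSimplex ℝ (Fin (k + 1)), X)) :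
    chainHom k (of σ) = ι ((simplexEquiv X k).symm σ) := lift_of _ _

lemma chainHom_cochainHom {k : ℕ} (φ : Cochain X (k + 1)) (c : Chain X (k + 1)) :
    chainHom k c ≫ cochainHom φ = eval φ c • 𝟙 _ := by
  induction c using Finsupp.induction_linear with
  | zero => simp
  | add f g hf hg => rw [map_add, map_add, Preadditive.add_comp, hf, hg, add_smul]
  | single σ a =>
    have : Finsupp.single σ a = a • of σ := by simp
    rw [this, map_smul, map_smul, chainHom_of, Preadditive.zsmul_comp, ι_cochainHom, eval_of,
      Equiv.apply_symm_apply, smul_eq_mul, mul_smul]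

lemma chainHom_d {k : ℕ} (c : Chain X (k + 2)) :
    chainHom (k + 1) c ≫ (chains (TopCat.of X)).d (k + 1) k = chainHom k (bd (k + 1) c) := by
  induction c using Finsupp.induction_linear with
  | zero => simp
  | add f g hf hg => rw [map_add, map_add, map_add, Preadditive.add_comp, hf, hg]
  | single σ a =>
    have : Finsupp.single σ a = a • of σ := by simp
    rw [this, map_smul, map_smul, map_smul, chainHom_of, Preadditive.zsmul_comp, ι_d, bd_of,
      map_sum]
    congr 1
    refine Finset.sum_congr rfl fun i _ => ?_
    rw [map_smul, chainHom_of]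
    congr 2

lemma chainHom_toRelChains {A : Set X} {k : ℕ} {c : Chain X (k + 1)}
    (hc : c ∈ chainsIn A (k + 1)) : chainHom k c ≫ (toRelChains A).f k = 0 := by
  let F : Chain X (k + 1) →ₗ[ℤ] (Coeff.{u} ⟶ (relChains A).X k) :=
    (AddMonoidHom.mk' (fun c => chainHom k c ≫ (toRelChains A).f k) fun a b => by
      rw [map_add, Preadditive.add_comp]).toIntLinearMap
  refine (Submodule.mem_bot ℤ).1 (map_mem_of_supp (f := F) (S := ⊥) (fun σ hσ => ?_) hc)
  rw [Submodule.mem_bot]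
  change chainHom k (of σ) ≫ (toRelChains A).f k = 0
  let τ : C(stdSimplex ℝ (Fin (k + 1)), A) :=
    ⟨fun t => ⟨σ t, hσ ⟨t, rfl⟩⟩, σ.continuous.subtype_mk _⟩
  have : ι ((simplexEquiv X k).symm σ) =
      ι ((simplexEquiv A k).symm τ) ≫ (chainsMap (incl A)).f k := by
    rw [incl, ι_chainsMap]
    congr 1
  rw [chainHom_of, this, Category.assoc, ← HomologicalComplex.comp_f, Limits.cokernel.condition,
    HomologicalComplex.zero_f, Limits.comp_zero]

/-- A cocycle is a chain map to the complex concentrated in degree `k`. It kills the chains of `A`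
and descends by the universal property, with no need to describe the cokernel degreewise. -/
lemma exists_relCochainHom {A : Set X} {k : ℕ} {φ : Cochain X (k + 1)} (hφ : φ ∈ rz A (k + 1)) :
    ∃ f : (relChains A).X k ⟶ Coeff.{u}, (relChains A).d (k + 1) k ≫ f = 0 ∧
      (toRelChains A).f k ≫ f = cochainHom φ := by
  let F : chains (TopCat.of X) ⟶ (single _ (ComplexShape.down ℕ) k).obj Coeff.{u} :=
    mkHomToSingle (cochainHom φ) fun i hi => by
      obtain rfl : k + 1 = i := hi
      exact d_cochainHom_eq_zero hφ.2
  have hF : chainsMap (incl A) ≫ F = 0 := by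
    refine to_single_hom_ext ?_
    rw [comp_f, mkHomToSingle_f, ← Category.assoc, incl, chainsMap_cochainHom]
    have : pull ⟨Subtype.val, continuous_subtype_val⟩ (k + 1) φ = (0 : Cochain A (k + 1)) := by
      funext σ
      refine hφ.1 _ ?_
      rintro _ ⟨t, rfl⟩
      exact (σ t).2
    rw [this, cochainHom_zero, Limits.zero_comp, zero_f]
  let G : relChains A ⟶ (single _ (ComplexShape.down ℕ) k).obj Coeff.{u} :=
    Limits.cokernel.desc _ F hF
  refine ⟨G.f k ≫ (singleObjXSelf _ k _).hom, ?_, ?_⟩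
  · rw [← Category.assoc, ← G.comm, single_obj_d, Limits.comp_zero, Limits.zero_comp]
  · rw [← Category.assoc, ← comp_f, Limits.cokernel.π_desc, mkHomToSingle_f, Category.assoc,
      Iso.inv_hom_id, Category.comp_id]

/-- The pairing of a cocycle with homology classes. -/
noncomputable def cocyclePairing {k : ℕ} (φ : LinearMap.ker (d (X := X) (k + 1))) :
    SingularHomology X k ⟶ Coeff.{u} :=
  pairing (K := chains (TopCat.of X)) (cochainHom φ.1) (d_cochainHom_eq_zero φ.2)

lemma pushforward_cocyclePairing {A : Set X} {k : ℕ} (φ : LinearMap.ker (d (X := X) (k + 1)))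
    (ψ : LinearMap.ker (d (X := A) (k + 1)))
    (h : ψ.1 = pull ⟨Subtype.val, continuous_subtype_val⟩ (k + 1) φ.1) :
    pushforward A k ≫ cocyclePairing φ = cocyclePairing ψ := by
  have h' : cochainHom ψ.1 = (chainsMap (incl A)).f k ≫ cochainHom φ.1 := by
    rw [h]; exact (chainsMap_cochainHom _ _).symm
  exact (homologyMap_pairing (chainsMap (incl A)) (cochainHom φ.1) _
    (h' ▸ d_cochainHom_eq_zero ψ.2)).trans (pairing_congr h'.symm _ _)

lemma cocyclePairing_add {k : ℕ} (φ ψ : LinearMap.ker (d (X := X) (k + 1))) :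
    cocyclePairing (φ + ψ) = cocyclePairing φ + cocyclePairing ψ := by
  have h := cochainHom_add φ.1 ψ.1
  have := pairing_add (K := chains (TopCat.of X)) (cochainHom φ.1) (cochainHom ψ.1)
    (d_cochainHom_eq_zero φ.2) (d_cochainHom_eq_zero ψ.2)
    (h ▸ d_cochainHom_eq_zero (φ + ψ).2)
  exact (pairing_congr h _ _).trans this

lemma cocyclePairing_eq_zero {k : ℕ} (φ : LinearMap.ker (d (X := X) (k + 2)))
    (h : φ.1 ∈ rb (∅ : Set X) (k + 1)) : cocyclePairing φ = 0 := by
  obtain ⟨ψ, -, hψ⟩ := h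
  have h' : cochainHom φ.1 = (chains (TopCat.of X)).d (k + 1) k ≫ cochainHom ψ := by
    rw [d_cochainHom, hψ]
  exact (pairing_congr h' _ _).trans (pairing_d (K := chains (TopCat.of X)) (cochainHom ψ)
    (h' ▸ d_cochainHom_eq_zero φ.2))

/-- If a relative cocycle annihilates a class that generates the relative homology, then it
vanishes on all relative cycles. -/
theorem eval_eq_zero_of_pairing {A : Set X} {k : ℕ} (φ : LinearMap.ker (d (X := X) (k + 2)))
    (hφ : φ.1 ∈ rz A (k + 2)) (b : SingularHomology X (k + 1))
    (hb : Submodule.span ℤ {toRel A (k + 1) b} = ⊤) (h : (cocyclePairing φ).hom b = 0)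
    (c : Chain X (k + 2)) (hc : bd (k + 1) c ∈ chainsIn A (k + 1)) : eval φ.1 c = 0 := by
  obtain ⟨f, hf, hf'⟩ := exists_relCochainHom hφ
  have hpair : toRel A (k + 1) ≫ pairing f hf = cocyclePairing φ := by
    exact (homologyMap_pairing (toRelChains A) f hf
      (hf'.symm ▸ d_cochainHom_eq_zero φ.2)).trans (pairing_congr hf' _ _)
  -- The relative pairing kills a generator, hence the whole group.
  have hzero : pairing f hf = 0 := by
    refine ModuleCat.hom_ext (LinearMap.ext fun z => ?_)
    obtain ⟨n, rfl⟩ := Submodule.mem_span_singleton.1 (hb.ge (Submodule.mem_top (x := z)))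
    have : (pairing f hf).hom (toRel A (k + 1) b) = 0 := by
      rw [← h, ← hpair]; rfl
    refine ((pairing f hf).hom.map_smul n _).trans ?_
    rw [this, smul_zero]
    rfl
  -- A relative cycle is an honest cycle of the quotient complex, so the vanishing pairing can be
  -- evaluated on it.
  have hcyc : (chainHom (k + 1) c ≫ (toRelChains A).f (k + 1)) ≫ (relChains A).d (k + 1) k = 0 := by
    rw [Category.assoc, (toRelChains A).comm, ← Category.assoc, chainHom_d]
    exact chainHom_toRelChains hc
  have := homologyπ_pairing (K := relChains A) f hf
  rw [hzero, Limits.comp_zero] at this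
  have h2 := congrArg (fun g => (relChains A).liftCycles
    (chainHom (k + 1) c ≫ (toRelChains A).f (k + 1)) k (by simp) hcyc ≫ g) this
  simp only [Limits.comp_zero, liftCycles_i_assoc, Category.assoc, hf', chainHom_cochainHom] at h2
  have h3 := congrArg (fun g => (g.hom (ULift.up 1)).down) h2
  simpa using h3.symm

end Pairing

end SingularChain

/-! ### Cup products on representatives and their naturality. -/

namespace IntegralCohomology

variable {X Y : SSet.{u}}

/-- The iterated cup product of cochains of degree one. -/
def cochainProd : (m : ℕ) → (Fin m → Cochain X 1) → Cochain X m
  | 0, _ => fun _ => 1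
  | m + 1, φ => cochainCup rfl (cochainProd m fun i => φ i.castSucc) (φ (Fin.last m))

lemma exists_cupProd_mk (m : ℕ) (φ : Fin m → cocycles X 1) :
    ∃ h : cochainProd m (fun i => (φ i).1) ∈ cocycles X m,
      cupProd m (fun i => (Submodule.Quotient.mk (φ i) : H X 1)) =
        Submodule.Quotient.mk ⟨_, h⟩ := by
  induction m with
  | zero => exact ⟨_, rfl⟩
  | succ m ih =>
    obtain ⟨h, h'⟩ := ih fun i => φ i.castSucc
    refine ⟨cochainCup_mem_cocycles rfl h (φ _).2, ?_⟩
    rw [cupProd, h']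
    rfl

/-- Restriction of cochains along a morphism of simplicial sets. -/
def cochainMap (g : X ⟶ Y) (k : ℕ) (φ : Cochain Y k) : Cochain X k := fun s => φ (g.app _ s)

lemma cochainMap_mem_cocycles (g : X ⟶ Y) {k : ℕ} {φ : Cochain Y k} (h : φ ∈ cocycles Y k) :
    cochainMap g k φ ∈ cocycles X k := by
  rw [cocycles, LinearMap.mem_ker] at *
  funext s
  refine Eq.trans ?_ (congrFun h (g.app _ s))
  change ∑ i : Fin (k + 2), (-1 : ℤ) ^ (i : ℕ) * φ (g.app _ (X.δ i s)) =
    ∑ i : Fin (k + 2), (-1 : ℤ) ^ (i : ℕ) * φ (Y.δ i (g.app _ s))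
  refine Finset.sum_congr rfl fun i _ => ?_
  congr 2
  exact NatTrans.naturality_apply g _ s

lemma cochainMap_cochainProd (g : X ⟶ Y) (m : ℕ) (φ : Fin m → Cochain Y 1) :
    cochainMap g m (cochainProd m φ) = cochainProd m fun i => cochainMap g 1 (φ i) := by
  induction m with
  | zero => rfl
  | succ m ih =>
    rw [cochainProd, cochainProd, ← ih]
    funext s
    simp only [cochainMap, cochainCup]
    congr 2
    · exact (NatTrans.naturality_apply g _ s).symm
    · exact (NatTrans.naturality_apply g _ s).symm

end IntegralCohomology

/-! ### Transfer of the top class and conclusion. -/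

namespace SingularChain

open Opposite Simplicial

variable {X Y : Type u} [TopologicalSpace X] [TopologicalSpace Y]

/-- A cochain on the singular simplicial set as a cochain on affine simplices. -/
noncomputable def ofSSet {k : ℕ}
    (φ : IntegralCohomology.Cochain (TopCat.toSSet.obj (TopCat.of X)) k) : Cochain X (k + 1) :=
  fun σ => φ ((simplexEquiv X k).symm σ)

lemma d_ofSSet {k : ℕ} (φ : IntegralCohomology.Cochain (TopCat.toSSet.obj (TopCat.of X)) k) :
    d (k + 1) (ofSSet φ) = ofSSet (IntegralCohomology.d _ k φ) := rfl

lemma ofSSet_injective {k : ℕ} : Function.Injective (ofSSet (X := X) (k := k)) := fun φ ψ h => by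
  funext s
  have := congrFun h (simplexEquiv X k s)
  simpa [ofSSet] using this

lemma ofSSet_surjective {k : ℕ} : Function.Surjective (ofSSet (X := X) (k := k)) := fun φ =>
  ⟨fun s => φ (simplexEquiv X k s), by funext σ; simp [ofSSet]⟩

lemma pull_ofSSet (f : C(X, Y)) {k : ℕ}
    (φ : IntegralCohomology.Cochain (TopCat.toSSet.obj (TopCat.of Y)) k) :
    pull f (k + 1) (ofSSet φ) =
      ofSSet (IntegralCohomology.cochainMap (TopCat.toSSet.map (TopCat.ofHom f)) k φ) := rfl

lemma mem_coboundaries_iff {k : ℕ}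
    (φ : IntegralCohomology.Cochain (TopCat.toSSet.obj (TopCat.of X)) (k + 1)) :
    φ ∈ IntegralCohomology.coboundaries _ (k + 1) ↔ ofSSet φ ∈ rb (∅ : Set X) (k + 1) := by
  constructor
  · rintro ⟨ψ, rfl⟩
    exact ⟨ofSSet ψ, fun σ hσ => (hσ ⟨stdSimplex.barycenter, rfl⟩).elim, d_ofSSet ψ⟩
  · rintro ⟨ψ, -, h⟩
    obtain ⟨ψ, rfl⟩ := ofSSet_surjective ψ
    exact ⟨ψ, ofSSet_injective h⟩

/-- A ball inside the chart target is homeomorphic to the whole Euclidean space, centre to centre.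
-/
lemma exists_isOpenEmbedding_chart {m : ℕ} [ChartedSpace (EuclideanSpace ℝ (Fin m)) X] (x : X) :
    ∃ e : C(EuclideanSpace ℝ (Fin m), X), Topology.IsOpenEmbedding e ∧ x ∈ Set.range e := by
  let c := chartAt (EuclideanSpace ℝ (Fin m)) x
  obtain ⟨r, hr, hb⟩ := Metric.mem_nhds_iff.1
    (c.open_target.mem_nhds (mem_chart_target (EuclideanSpace ℝ (Fin m)) x))
  let f := (OpenPartialHomeomorph.univBall (c x) r).trans c.symm
  have hsource : f.source = Set.univ := by
    refine Set.eq_univ_of_forall fun y => ?_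
    rw [OpenPartialHomeomorph.trans_source]
    refine ⟨by simp, hb ?_⟩
    rw [← OpenPartialHomeomorph.univBall_target (c x) hr]
    exact (OpenPartialHomeomorph.univBall (c x) r).map_source (by simp)
  have hf : Topology.IsOpenEmbedding f := f.isOpenEmbedding hsource
  refine ⟨⟨f, hf.continuous⟩, hf, 0, ?_⟩
  change c.symm (OpenPartialHomeomorph.univBall (c x) r 0) = x
  rw [OpenPartialHomeomorph.univBall_apply_zero]
  exact c.left_inv (mem_chart_source _ x)

lemma pull_restrictTo (f : C(X, Y)) (C : Set Y) {k : ℕ} (φ : Cochain Y k) :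
    pull f k (restrictTo C k φ) = restrictTo (f ⁻¹' C) k (pull f k φ) := by
  funext σ
  classical
  have h : Set.range (f.comp σ) ⊆ C ↔ Set.range σ ⊆ f ⁻¹' C := by
    simp [Set.range_subset_iff]
  rw [pull_apply, restrictTo_apply, restrictTo_apply, if_congr h rfl rfl, pull_apply]

/-- Local consistency is automatic for restrictions of one global class: the whole space serves as
neighbourhood of every point. -/
lemma isOrientable_of_isFundamentalClass {k : ℕ} {c : SingularHomology X k}
    (h : IsFundamentalClass k X c) : IsOrientable k X := by
  refine ⟨fun x => IntegralHomology.toRel {x}ᶜ k c, h, fun x => ⟨Set.univ, isOpen_univ, trivial,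
    IntegralHomology.toRel Set.univᶜ k c, fun y hy => ?_⟩⟩
  have hle := Set.compl_subset_compl.2 (Set.singleton_subset_iff.2 hy)
  have e : IntegralHomology.toRelChains Set.univᶜ ≫ IntegralHomology.relChainsOfLE hle =
      IntegralHomology.toRelChains {y}ᶜ := Limits.cokernel.π_desc _ _ _
  have hc := HomologicalComplex.homologyMap_comp (IntegralHomology.toRelChains Set.univᶜ)
    (IntegralHomology.relChainsOfLE hle) k
  rw [e] at hc
  exact (ConcreteCategory.congr_hom hc c).symm

/-- If the inclusion of `A₀` into `M` has a left inverse up to homotopy, then a cocycle of top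
degree on the closed manifold `A₀` which becomes a coboundary on a homologous subspace is itself a
coboundary. -/
theorem mem_rb_of_homologous {M : Type u} [TopologicalSpace M] {k : ℕ} {A A₀ : Set M} [T2Space A₀]
    [CompactSpace A₀] [ChartedSpace (EuclideanSpace ℝ (Fin (k + 1))) A₀] (ρ : C(M, A₀))
    (hρ : (ρ.comp ⟨Subtype.val, continuous_subtype_val⟩).Homotopic (ContinuousMap.id A₀))
    {a : SingularHomology A (k + 1)} {b : SingularHomology A₀ (k + 1)}
    (hb : IsFundamentalClass (k + 1) A₀ b)
    (hab : IntegralHomology.pushforward A (k + 1) a = IntegralHomology.pushforward A₀ (k + 1) b)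
    (φ : LinearMap.ker (d (X := A₀) (k + 2)))
    (h : pull (ρ.comp (⟨Subtype.val, continuous_subtype_val⟩ : C(A, M))) (k + 2) φ.1 ∈
      rb (∅ : Set A) (k + 1)) :
    φ.1 ∈ rb (∅ : Set A₀) (k + 1) := by
  let j : C(A, M) := ⟨Subtype.val, continuous_subtype_val⟩
  let i : C(A₀, M) := ⟨Subtype.val, continuous_subtype_val⟩
  have hker : ∀ {X Y : Type u} [TopologicalSpace X] [TopologicalSpace Y] (f : C(X, Y)) {l : ℕ}
      (ψ : LinearMap.ker (d (X := Y) l)), pull f l ψ.1 ∈ LinearMap.ker (d (X := X) l) :=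
    fun f l ψ => by rw [LinearMap.mem_ker, d_pull, LinearMap.mem_ker.1 ψ.2, map_zero]
  -- The functional is evaluation on the fundamental class `b`.
  let L : LinearMap.ker (d (X := A₀) (k + 2)) →ₗ[ℤ] ℤ :=
    (AddMonoidHom.mk' (fun φ => ((cocyclePairing φ).hom b).down) fun φ ψ => by
      rw [cocyclePairing_add]; rfl).toIntLinearMap
  have hL : ∀ φ, L φ = ((cocyclePairing φ).hom b).down := fun _ => rfl
  refine mem_rb_of_functional (fun x => exists_isOpenEmbedding_chart x) k.succ_ne_zero L
    (fun ψ hψ => ?_) (fun x ψ hψ h0 c hc => ?_) φ (fun C hC ψ hψ => ?_)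
  · rw [hL, cocyclePairing_eq_zero ψ hψ]
    rfl
  · exact eval_eq_zero_of_pairing ψ hψ b (hb x) (ULift.ext _ _ h0) c hc
  · obtain ⟨H⟩ := hρ
    have hψz : ψ.1 ∈ rz (∅ : Set A₀) (k + 2) :=
      ⟨fun σ hσ => (hσ ⟨stdSimplex.barycenter, rfl⟩).elim, ψ.2⟩
    have hdiff : ψ.1 - pull i (k + 2) (pull ρ (k + 2) ψ.1) ∈ rb (∅ : Set A₀) (k + 1) :=
      exists_pull_sub_pull_eq H (V := ∅) (W := ∅) (fun _ _ h => h.elim) hψz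
    let ψM : LinearMap.ker (d (X := M) (k + 2)) := ⟨_, hker ρ ψ⟩
    let ψ₀ : LinearMap.ker (d (X := A₀) (k + 2)) := ⟨_, hker i ψM⟩
    let ψA : LinearMap.ker (d (X := A) (k + 2)) := ⟨_, hker j ψM⟩
    have h1 : cocyclePairing ψ = cocyclePairing ψ₀ := by
      have : ψ = (ψ - ψ₀) + ψ₀ := by abel
      rw [this, cocyclePairing_add, cocyclePairing_eq_zero (ψ - ψ₀) hdiff, zero_add]
    have h2 : (cocyclePairing ψ₀).hom b =
        (cocyclePairing ψM).hom (IntegralHomology.pushforward A₀ (k + 1) b) := by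
      rw [← pushforward_cocyclePairing ψM ψ₀ rfl]; rfl
    have h3 : (cocyclePairing ψA).hom a =
        (cocyclePairing ψM).hom (IntegralHomology.pushforward A (k + 1) a) := by
      rw [← pushforward_cocyclePairing ψM ψA rfl]; rfl
    -- Pulling back the part over `C` gives the part over the preimage of `C`, and clopen
    -- restriction preserves coboundaries.
    have h4 : ψA.1 ∈ rb (∅ : Set A) (k + 1) := by
      have : ψA.1 = restrictTo ((ρ.comp j) ⁻¹' C) (k + 2) (pull (ρ.comp j) (k + 2) φ.1) := by
        rw [← pull_restrictTo, ← hψ]; rfl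
      rw [this]
      obtain ⟨χ, -, hχ⟩ := h
      rw [← hχ, ← d_restrictTo (hC.preimage (ρ.comp j).continuous)]
      exact ⟨_, fun σ hσ => (hσ ⟨stdSimplex.barycenter, rfl⟩).elim, rfl⟩
    rw [hL, h1, h2, ← hab, ← h3, cocyclePairing_eq_zero ψA h4]
    rfl

end SingularChain

open SingularChain IntegralCohomology in
/-- A subspace homologous to a closed manifold `A₀` which is a retract up to homotopy inherits the
cohomology condition. -/
theorem CohomologyCondition.of_homologous {M : Type u} [TopologicalSpace M] {m : ℕ} (hm : m ≠ 0)
    {A A₀ : Set M} [T2Space A₀] [CompactSpace A₀] [ChartedSpace (EuclideanSpace ℝ (Fin m)) A₀]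
    (hhomotopy : HomotopyCondition A₀) (hcohomology : CohomologyCondition m A₀)
    (hhomologous : Homologous m A A₀) : CohomologyCondition m A := by
  obtain ⟨k, rfl⟩ := Nat.exists_eq_succ_of_ne_zero hm
  obtain ⟨ρ, hρ⟩ := hhomotopy
  obtain ⟨a, b, ha, hb, hab⟩ := hhomologous
  obtain ⟨-, w, hw⟩ := hcohomology
  refine ⟨isOrientable_of_isFundamentalClass ha, ?_⟩
  choose φ hφ using fun i => Submodule.Quotient.mk_surjective _ (w i)
  obtain rfl : (fun i => Submodule.Quotient.mk (φ i)) = w := funext hφ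
  let f : C(A, A₀) := ρ.comp ⟨Subtype.val, continuous_subtype_val⟩
  let g := TopCat.toSSet.map (TopCat.ofHom f)
  -- The required classes are the pullbacks of the given ones along `f`; if their product vanished,
  -- so would the original product.
  refine ⟨fun i => Submodule.Quotient.mk ⟨_, cochainMap_mem_cocycles g (φ i).2⟩, fun h => hw ?_⟩
  obtain ⟨hP, hP'⟩ := exists_cupProd_mk (k + 1) φ
  obtain ⟨hQ, hQ'⟩ := exists_cupProd_mk (k + 1) fun i =>
    (⟨_, cochainMap_mem_cocycles g (φ i).2⟩ : cocycles _ 1)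
  have h' := (Submodule.Quotient.mk_eq_zero _).1 (hQ'.symm.trans h)
  replace h := (mem_coboundaries_iff _).1 (Submodule.mem_comap.1 h')
  refine hP'.trans ((Submodule.Quotient.mk_eq_zero _).2 ((mem_coboundaries_iff _).2 ?_))
  refine mem_rb_of_homologous ρ hρ hb hab
    ⟨ofSSet (cochainProd (k + 1) fun i => (φ i).1), ?_⟩ ?_
  · rw [LinearMap.mem_ker, d_ofSSet, LinearMap.mem_ker.1 hP]
    rfl
  · change pull f (k + 2) (ofSSet (cochainProd (k + 1) fun i => (φ i).1)) ∈ _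
    rw [pull_ofSSet, cochainMap_cochainProd]
    exact h

theorem lemma3p1 (n : ℕ) [NeZero n] (hn : 3 ≤ n)
    (M : Type u) [TopologicalSpace M] [T2Space M] [CompactSpace M]
    [ChartedSpace (EuclideanHalfSpace n) M] [IsManifold (𝓡∂ n) ∞ M]
    (hM : IsOrientable n ((𝓡∂ n).interior M))
    (A₀ S : Set M) (hA₀ : IsClosedHypersurface n A₀) (hS : IsClosedHypersurface n S)
    (hdisj : Disjoint A₀ S) (hboundary : (𝓡∂ n).boundary M = A₀ ∪ S)
    (hhomotopy : HomotopyCondition A₀) (hcohomology : CohomologyCondition (n - 1) A₀)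
    (A : Set M) (hA : IsClosedHypersurface n A) (hhomologous : Homologous (n - 1) A A₀) :
    CohomologyCondition (n - 1) A := by
  -- The anonymous component is the atlas on `A₀`, left in context for instance search.
  obtain ⟨hcompact, _, -⟩ := hA₀
  have : CompactSpace A₀ := isCompact_iff_compactSpace.1 hcompact
  exact CohomologyCondition.of_homologous (by omega) hhomotopy hcohomology hhomologous
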